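/- There are absolute constants $C_1, C_2, C_3 > 0$ such that the following holds. Let $1 \le s \le p$ and $n$ be integers, and let $x_1, \dots, x_n$ be i.i.d. $\mathcal{N}(\mu, \Sigma)$ random vectors in $\mathbf{R}^p$, where the covariance matrix is $\Sigma = \sigma_1 v_1 \otimes v_1 + \Sigma_2$, the vector $v_1$ has $\|v_1\|_2 = 1$ and at most $s$ nonzero entries, $\Sigma_2 v_1 = 0$, and $\sigma_1 > \sigma_2 := \|\Sigma_2\|$ (spectral norm). For $B \in \mathbf{R}^{p \times p}$ let $\|B\|_*$ be the nuclear norm, $\|B\|_F$ the Frobenius norm, and let $$\|B\|_{*,s} = \inf\Big\{ \sum_k \theta_s(u_k, v_k) : B = \sum_k u_k \otimes v_k \Big\}, \qquad \theta_s(u,v) = \Big(\|u\|_2 + \tfrac{1}{\sqrt{s}} \|u\|_1\Big)\Big(\|v\|_2 + \tfrac{1}{\sqrt{s}} \|v\|_1\Big).$$ Let $\bar{x} = \frac{1}{n}\sum_i x_i$ and $\hat\Sigma = \frac{1}{n} \sum_{i=1}^n (x_i - \bar x) \otimes (x_i - \bar x)$. Let $$\lambda \ge C_1 \sqrt{\sigma_1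 \sigma_2} \sqrt{\frac{s \log(ep/s)}{n}},$$ let $t > 0$, and suppose $$n \ge C_2 \max\Big\{ s \log \frac{ep}{s}, \Big(\frac{\sigma_1}{\sigma_1 - \sigma_2}\Big)^2 t \Big\}.$$ Then, with probability at least $1 - e^{-t} - 3 e^{-s} (s/p)^s$, the program $$\min_{P \in \mathbf{R}^{p \times p}} \; -\langle \hat\Sigma, P \rangle_{\mathrm{HS}} + \lambda \|P\|_{*,s} \quad \text{subject to} \quad \|P\|_* \le 1$$ has a solution, and every solution $\hat P$ satisfies $$\|\hat P - v_1 \otimes v_1\|_F \le C_3 \frac{\lambda}{\sigma_1 - \sigma_2}.$$ -/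

import Mathlib

noncomputable section

namespace SparsePCA

/-- The rank-one matrix `u ⊗ v = u vᵀ`, with entries `u i * v j`. -/
def outer {p : ℕ} (u v : EuclideanSpace ℝ (Fin p)) : Matrix (Fin p) (Fin p) ℝ :=
  Matrix.of fun i j => u i * v j

/-- The `ℓ₁` norm of a vector. -/
def l1Norm {p : ℕ} (u : EuclideanSpace ℝ (Fin p)) : ℝ := ∑ i, |u i|

/-- A vector is `s`-sparse if it has at most `s` nonzero entries. -/
def IsSparse {p : ℕ} (s : ℕ) (u : EuclideanSpace ℝ (Fin p)) : Prop :=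
  {i : Fin p | u i ≠ 0}.ncard ≤ s

/-- The Hilbert-Schmidt (Frobenius) inner product `tr (Aᵀ B) = ∑ i j, A i j * B i j`. -/
def hsInner {p : ℕ} (A B : Matrix (Fin p) (Fin p) ℝ) : ℝ := (A.transpose * B).trace

/-- The Frobenius norm. -/
def frobNorm {p : ℕ} (A : Matrix (Fin p) (Fin p) ℝ) : ℝ := √(∑ i, ∑ j, A i j ^ 2)

/-- The spectral norm (the operator norm for the Euclidean norm on `ℝᵖ`). -/
def opNorm {p : ℕ} (A : Matrix (Fin p) (Fin p) ℝ) : ℝ :=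
  ‖Matrix.toEuclideanCLM (n := Fin p) (𝕜 := ℝ) A‖

/-- The infimum of `∑ k, θ (u k) (v k)` over all finite decompositions
`A = ∑ k, u k ⊗ v k` into rank-one matrices. -/
def atomicNorm {p : ℕ} (θ : EuclideanSpace ℝ (Fin p) → EuclideanSpace ℝ (Fin p) → ℝ)
    (A : Matrix (Fin p) (Fin p) ℝ) : ℝ :=
  sInf {r : ℝ | ∃ (K : ℕ) (u v : Fin K → EuclideanSpace ℝ (Fin p)),
    A = ∑ k, outer (u k) (v k) ∧ r = ∑ k, θ (u k) (v k)}

/-- The nuclear norm, as the projective tensor norm of `ℓ₂ ⊗ ℓ₂`: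
`‖A‖_* = inf {∑ ‖u k‖₂ ‖v k‖₂ : A = ∑ u k ⊗ v k}`. -/
def nuclearNorm {p : ℕ} (A : Matrix (Fin p) (Fin p) ℝ) : ℝ :=
  atomicNorm (fun u v => ‖u‖ * ‖v‖) A

/-- `θ_s(u, v) = (‖u‖₂ + ‖u‖₁ / √s) (‖v‖₂ + ‖v‖₁ / √s)`. -/
def theta {p : ℕ} (s : ℕ) (u v : EuclideanSpace ℝ (Fin p)) : ℝ :=
  (‖u‖ + l1Norm u / √(s : ℝ)) * (‖v‖ + l1Norm v / √(s : ℝ))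

/-- The mixed atomic norm `‖A‖_{*,s} = inf {∑ θ_s(u k, v k) : A = ∑ u k ⊗ v k}`. -/
def mixedNorm {p : ℕ} (s : ℕ) (A : Matrix (Fin p) (Fin p) ℝ) : ℝ :=
  atomicNorm (theta s) A

/-- The empirical mean of `x 0, …, x (n - 1)`. -/
def empMean {p n : ℕ} (x : Fin n → EuclideanSpace ℝ (Fin p)) : EuclideanSpace ℝ (Fin p) :=
  (1 / (n : ℝ)) • ∑ i, x i

/-- The empirical covariance `(1/n) ∑ i, (x i - x̄) ⊗ (x i - x̄)`. -/
def empCov {p n : ℕ} (x : Fin n → EuclideanSpace ℝ (Fin p)) : Matrix (Fin p) (Fin p) ℝ :=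
  (1 / (n : ℝ)) • ∑ i, outer (x i - empMean x) (x i - empMean x)

/-- The objective `-⟨S, P⟩ + lam ‖P‖_{*,s}`. -/
def pcaObjective {p : ℕ} (s : ℕ) (lam : ℝ) (S P : Matrix (Fin p) (Fin p) ℝ) : ℝ :=
  -hsInner S P + lam * mixedNorm s P

/-- `P` is a minimizer of the objective over the nuclear-norm unit ball of `ℝ^{p × p}`. -/
def IsPCASolution {p : ℕ} (s : ℕ) (lam : ℝ) (S P : Matrix (Fin p) (Fin p) ℝ) : Prop :=
  nuclearNorm P ≤ 1 ∧
    ∀ Q : Matrix (Fin p) (Fin p) ℝ, nuclearNorm Q ≤ 1 →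
      pcaObjective s lam S P ≤ pcaObjective s lam S Q

end SparsePCA

end

/-!
Let `S` be the empirical covariance, `L = s log (e p / s)`, `v = v₁`, and let `N u = ‖u‖₂ + ‖u‖₁ / √s`
be the norm whose tensor square is `theta s`.

*Deterministic part.* Suppose that, up to `η ≍ √(σ₁ σ₂ L / n)`, the bilinear form of `S` agrees
with that of `Σ₂` on the complement of `v`, and that its cross terms between `v` and the complement
are small, all measured by `N`; suppose also that `vᵀ S v - σ₂ ≥ (σ₁ - σ₂) / 2`. A dual bound
`|uᵀ A u'| ≤ c N u N u'` alone would only give `⟨A, P - v ⊗ v⟩ ≤ c ‖P - v ⊗ v‖_{*,s}`, and hence the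
square root of the claimed rate. The linear rate rests on a decomposability property of the mixed
norm at `v ⊗ v`: if `w` is the subgradient `v + sign v / √s` of `N` at `v`, the cost `N x N y` of
every atom exceeds `⟨w, x⟩⟨w, y⟩` by a fixed fraction of the cost of its part transversal to `v ⊗ v`
(`atom_excess`). The noise is therefore bounded by `η` times
`‖P - v ⊗ v‖_F + (‖P‖_{*,s} - ⟨w ⊗ w, P⟩)` (`noise_le`), and the second summand is absorbed by the
regularization. Comparing the objective at a solution and at `v ⊗ v` leaves
`(σ₁ - σ₂) (1 - vᵀ P v) ≲ λ ‖P - v ⊗ v‖_F`, while `‖P - v ⊗ v‖_F² ≤ 2 (1 - vᵀ P v)` on the nuclear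
norm ball (`frobNorm_sub_le`). Solutions exist because both norms are continuous and the nuclear norm
ball is compact (`exists_isPCASolution`).

*Uniform part.* A symmetric bilinear form whose quadratic form is small on all integer vectors of
`ℓ₁` norm at most `8 s` is small for `N` (`abs_le_mixN_of_intVec`): sparse unit vectors are rounded to
the lattice `ℤᵖ / (4 √s)`, and general vectors are cut into blocks of `s` entries in decreasing order.
There are at most `e^{10 L}` such integer vectors (`card_intBall_le`). The variables are rescaled
so that the spiked covariance is at most the identity, which turns one estimate into the
right bounds both for the cross terms and for the complement.

*Probabilistic part.* For a fixed direction `d`, the number `dᵀ S d` is a multiple of the empirical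
variance of standard Gaussian variables, so only Chernoff bounds for sums of squares are needed. The
lower tail of `vᵀ S v` must have probability at most `e^{-t}` also for small `t`, where a union bound
is useless; there a Paley–Zygmund argument shows that the empirical variance exceeds `1` with
probability bounded below (`emp_var_lower_tail`).
-/

namespace SparsePCA

open scoped RealInnerProductSpace

variable {p : ℕ}

/-! ### Bilinear forms of matrices and atomic norms -/

/-- The bilinear form `(u, v) ↦ uᵀ A v` of a matrix. -/
noncomputable def bilin (A : Matrix (Fin p) (Fin p) ℝ) :
    EuclideanSpace ℝ (Fin p) →ₗ[ℝ] EuclideanSpace ℝ (Fin p) →ₗ[ℝ] ℝ :=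
  LinearMap.mk₂ ℝ (fun u v => ∑ i, ∑ j, A i j * (u i * v j))
    (fun u u' v => by
      simp only [← Finset.sum_add_distrib, PiLp.add_apply]
      exact Finset.sum_congr rfl fun i _ => Finset.sum_congr rfl fun j _ => by ring)
    (fun c u v => by
      simp only [smul_eq_mul, Finset.mul_sum, PiLp.smul_apply]
      exact Finset.sum_congr rfl fun i _ => Finset.sum_congr rfl fun j _ => by ring)
    (fun u v v' => by
      simp only [← Finset.sum_add_distrib, PiLp.add_apply]
      exact Finset.sum_congr rfl fun i _ => Finset.sum_congr rfl fun j _ => by ring)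
    (fun c u v => by
      simp only [smul_eq_mul, Finset.mul_sum, PiLp.smul_apply]
      exact Finset.sum_congr rfl fun i _ => Finset.sum_congr rfl fun j _ => by ring)

lemma bilin_apply (A : Matrix (Fin p) (Fin p) ℝ) (u v : EuclideanSpace ℝ (Fin p)) :
    bilin A u v = ∑ i, ∑ j, A i j * (u i * v j) := rfl

lemma hsInner_eq_sum (A B : Matrix (Fin p) (Fin p) ℝ) :
    hsInner A B = ∑ i, ∑ j, A i j * B i j := by
  simp only [hsInner, Matrix.trace, Matrix.diag, Matrix.mul_apply, Matrix.transpose_apply]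
  exact Finset.sum_comm

lemma hsInner_outer (A : Matrix (Fin p) (Fin p) ℝ) (u v : EuclideanSpace ℝ (Fin p)) :
    hsInner A (outer u v) = bilin A u v := by
  simp [hsInner_eq_sum, bilin_apply, outer]

lemma hsInner_sum_outer {ι : Type*} (t : Finset ι) (A : Matrix (Fin p) (Fin p) ℝ)
    (u v : ι → EuclideanSpace ℝ (Fin p)) :
    hsInner A (∑ k ∈ t, outer (u k) (v k)) = ∑ k ∈ t, bilin A (u k) (v k) := by
  simp only [← hsInner_outer, hsInner, Matrix.mul_sum, Matrix.trace_sum]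

lemma hsInner_add_left (A B C : Matrix (Fin p) (Fin p) ℝ) :
    hsInner (A + B) C = hsInner A C + hsInner B C := by
  simp [hsInner, Matrix.add_mul]

lemma hsInner_sub_left (A B C : Matrix (Fin p) (Fin p) ℝ) :
    hsInner (A - B) C = hsInner A C - hsInner B C := by
  simp [hsInner, Matrix.sub_mul]

lemma hsInner_smul_left (c : ℝ) (A B : Matrix (Fin p) (Fin p) ℝ) :
    hsInner (c • A) B = c * hsInner A B := by
  simp [hsInner]

lemma hsInner_sub_right (A B C : Matrix (Fin p) (Fin p) ℝ) :
    hsInner A (B - C) = hsInner A B - hsInner A C := by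
  simp [hsInner, Matrix.mul_sub]

lemma inner_eq_sum (u v : EuclideanSpace ℝ (Fin p)) : ⟪u, v⟫ = ∑ i, u i * v i := by
  simp [PiLp.inner_apply, mul_comm]

lemma bilin_outer (a b u v : EuclideanSpace ℝ (Fin p)) :
    bilin (outer a b) u v = ⟪a, u⟫ * ⟪b, v⟫ := by
  rw [bilin_apply, inner_eq_sum, inner_eq_sum, Finset.sum_mul_sum]
  exact Finset.sum_congr rfl fun i _ => Finset.sum_congr rfl fun j _ => by
    simp [outer]; ring

lemma hsInner_outer_left (a b : EuclideanSpace ℝ (Fin p)) (A : Matrix (Fin p) (Fin p) ℝ) :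
    hsInner (outer a b) A = bilin A a b := by
  rw [hsInner_eq_sum, bilin_apply]
  exact Finset.sum_congr rfl fun i _ => Finset.sum_congr rfl fun j _ => by
    simp [outer]; ring

lemma bilin_add (A B : Matrix (Fin p) (Fin p) ℝ) (u v : EuclideanSpace ℝ (Fin p)) :
    bilin (A + B) u v = bilin A u v + bilin B u v := by
  simp only [← hsInner_outer, hsInner_add_left]

lemma bilin_sub (A B : Matrix (Fin p) (Fin p) ℝ) (u v : EuclideanSpace ℝ (Fin p)) :
    bilin (A - B) u v = bilin A u v - bilin B u v := by
  simp only [← hsInner_outer, hsInner_sub_left]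

lemma bilin_smul (c : ℝ) (A : Matrix (Fin p) (Fin p) ℝ) (u v : EuclideanSpace ℝ (Fin p)) :
    bilin (c • A) u v = c * bilin A u v := by
  simp only [← hsInner_outer, hsInner_smul_left]

lemma bilin_symm {A : Matrix (Fin p) (Fin p) ℝ} (hA : A.transpose = A)
    (u v : EuclideanSpace ℝ (Fin p)) : bilin A u v = bilin A v u := by
  rw [bilin_apply, bilin_apply, Finset.sum_comm]
  refine Finset.sum_congr rfl fun i _ => Finset.sum_congr rfl fun j _ => ?_
  rw [← Matrix.transpose_apply A, hA]; ring

lemma bilin_eq_inner (A : Matrix (Fin p) (Fin p) ℝ) (u v : EuclideanSpace ℝ (Fin p)) :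
    bilin A u v = ⟪u, Matrix.toEuclideanCLM (n := Fin p) (𝕜 := ℝ) A v⟫ := by
  rw [inner_eq_sum, bilin_apply]
  refine Finset.sum_congr rfl fun i _ => ?_
  have : (Matrix.toEuclideanCLM (n := Fin p) (𝕜 := ℝ) A v) i = ∑ j, A i j * v j := by
    simp [Matrix.ofLp_toEuclideanCLM, Matrix.mulVec, dotProduct]
  rw [this, Finset.mul_sum]
  exact Finset.sum_congr rfl fun j _ => by ring

lemma abs_bilin_le_opNorm (A : Matrix (Fin p) (Fin p) ℝ) (u v : EuclideanSpace ℝ (Fin p)) :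
    |bilin A u v| ≤ opNorm A * (‖u‖ * ‖v‖) := by
  rw [bilin_eq_inner]
  calc _ ≤ ‖u‖ * ‖Matrix.toEuclideanCLM (n := Fin p) (𝕜 := ℝ) A v‖ := abs_real_inner_le_norm _ _
    _ ≤ ‖u‖ * (opNorm A * ‖v‖) := by
      gcongr; exact ContinuousLinearMap.le_opNorm _ _
    _ = _ := by ring

section Atomic

variable {θ : EuclideanSpace ℝ (Fin p) → EuclideanSpace ℝ (Fin p) → ℝ}

lemma atomicNorm_le (hθ : ∀ u v, 0 ≤ θ u v) {ι : Type*} [Fintype ι]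
    {A : Matrix (Fin p) (Fin p) ℝ} (u v : ι → EuclideanSpace ℝ (Fin p))
    (h : A = ∑ k, outer (u k) (v k)) : atomicNorm θ A ≤ ∑ k, θ (u k) (v k) := by
  refine csInf_le ⟨0, ?_⟩ ⟨Fintype.card ι, u ∘ (Fintype.equivFin ι).symm,
    v ∘ (Fintype.equivFin ι).symm, ?_, ?_⟩
  · rintro r ⟨K, u, v, -, rfl⟩
    exact Finset.sum_nonneg fun k _ => hθ _ _
  · rw [h]
    exact (Equiv.sum_comp (Fintype.equivFin ι).symm fun k => outer (u k) (v k)).symm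
  · exact (Equiv.sum_comp (Fintype.equivFin ι).symm fun k => θ (u k) (v k)).symm

/-- The expansion of a matrix in the standard basis; it shows that every matrix has an atomic
decomposition. -/
lemma eq_sum_outer_single (A : Matrix (Fin p) (Fin p) ℝ) :
    A = ∑ k : Fin p × Fin p, outer (A k.1 k.2 • EuclideanSpace.single k.1 (1 : ℝ))
      (EuclideanSpace.single k.2 (1 : ℝ)) := by
  ext i j
  rw [Matrix.sum_apply, Fintype.sum_prod_type, Finset.sum_eq_single i, Finset.sum_eq_single j]
  · simp [outer]
  · intro b _ hb; simp [outer, hb.symm]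
  · simp
  · intro b _ hb
    exact Finset.sum_eq_zero fun c _ => by simp [outer, hb.symm]
  · simp

lemma le_atomicNorm {A : Matrix (Fin p) (Fin p) ℝ} {c : ℝ}
    (h : ∀ (K : ℕ) (u v : Fin K → EuclideanSpace ℝ (Fin p)), A = ∑ k, outer (u k) (v k) →
      c ≤ ∑ k, θ (u k) (v k)) : c ≤ atomicNorm θ A := by
  refine le_csInf ?_ ?_
  · refine ⟨_, Fintype.card (Fin p × Fin p), _, _, (eq_sum_outer_single A).trans
      (Equiv.sum_comp (Fintype.equivFin (Fin p × Fin p)).symm _).symm, rfl⟩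
  · rintro r ⟨K, u, v, hA, rfl⟩
    exact h K u v hA

lemma atomicNorm_nonneg (hθ : ∀ u v, 0 ≤ θ u v) (A : Matrix (Fin p) (Fin p) ℝ) :
    0 ≤ atomicNorm θ A :=
  le_atomicNorm fun _ _ _ _ => Finset.sum_nonneg fun _ _ => hθ _ _

lemma atomicNorm_add_le (hθ : ∀ u v, 0 ≤ θ u v) (A B : Matrix (Fin p) (Fin p) ℝ) :
    atomicNorm θ (A + B) ≤ atomicNorm θ A + atomicNorm θ B := by
  rw [← sub_le_iff_le_add]
  refine le_atomicNorm fun K u v hA => ?_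
  rw [sub_le_comm]
  refine le_atomicNorm fun K' u' v' hB => ?_
  rw [sub_le_iff_le_add']
  refine (atomicNorm_le hθ (Sum.elim u u') (Sum.elim v v') ?_).trans_eq ?_
  · rw [hA, hB, Fintype.sum_sum_type]; rfl
  · rw [Fintype.sum_sum_type]; rfl

lemma atomicNorm_le_sum_abs (hθ : ∀ u v, 0 ≤ θ u v)
    (hsmul : ∀ (c : ℝ) u v, θ (c • u) v = |c| * θ u v) (A : Matrix (Fin p) (Fin p) ℝ) :
    atomicNorm θ A ≤ ∑ k : Fin p × Fin p, |A k.1 k.2| *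
      θ (EuclideanSpace.single k.1 (1 : ℝ)) (EuclideanSpace.single k.2 (1 : ℝ)) := by
  refine (atomicNorm_le hθ _ _ (eq_sum_outer_single A)).trans_eq ?_
  simp only [hsmul]

lemma continuous_atomicNorm (hθ : ∀ u v, 0 ≤ θ u v)
    (hsmul : ∀ (c : ℝ) u v, θ (c • u) v = |c| * θ u v) :
    Continuous (atomicNorm θ : Matrix (Fin p) (Fin p) ℝ → ℝ) := by
  set g : Matrix (Fin p) (Fin p) ℝ → ℝ := fun A => ∑ k : Fin p × Fin p, |A k.1 k.2| *
      θ (EuclideanSpace.single k.1 (1 : ℝ)) (EuclideanSpace.single k.2 (1 : ℝ)) with hg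
  have hgc : Continuous g := by
    refine continuous_finsetSum _ fun k _ => ?_
    have : Continuous fun A : Matrix (Fin p) (Fin p) ℝ => A k.1 k.2 :=
      (continuous_apply_apply k.1 k.2 : Continuous fun A : Fin p → Fin p → ℝ => A k.1 k.2)
    exact this.abs.mul continuous_const
  have hdiff : ∀ A B, |atomicNorm θ A - atomicNorm θ B| ≤ g (A - B) := by
    intro A B
    rw [abs_sub_le_iff]
    constructor
    · have h1 := atomicNorm_add_le hθ (A - B) B
      have h2 := atomicNorm_le_sum_abs hθ hsmul (A - B)
      rw [sub_add_cancel] at h1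
      linarith
    · have h1 := atomicNorm_add_le hθ (B - A) A
      have h2 := atomicNorm_le_sum_abs hθ hsmul (B - A)
      rw [sub_add_cancel] at h1
      have h3 : g (A - B) = g (B - A) := by
        simp only [hg, Matrix.sub_apply]
        exact Finset.sum_congr rfl fun k _ => by rw [abs_sub_comm]
      rw [h3]
      linarith
  rw [continuous_iff_continuousAt]
  intro B
  rw [ContinuousAt, tendsto_iff_dist_tendsto_zero]
  have hlim : Filter.Tendsto (fun A => g (A - B)) (nhds B) (nhds 0) := by
    have h0 : g (B - B) = 0 := by simp [hg]
    rw [← h0]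
    exact (hgc.comp (continuous_id.sub continuous_const)).tendsto B
  exact squeeze_zero (fun _ => dist_nonneg) (fun A => by rw [Real.dist_eq]; exact hdiff A B) hlim

/-- A matrix whose bilinear form is dominated by `θ` lies in the unit ball of the dual of the
atomic norm. -/
lemma hsInner_le_atomicNorm {c : ℝ} (hc : 0 ≤ c) {A : Matrix (Fin p) (Fin p) ℝ}
    (h : ∀ u v, bilin A u v ≤ c * θ u v) (P : Matrix (Fin p) (Fin p) ℝ) :
    hsInner A P ≤ c * atomicNorm θ P := by
  have key : ∀ (K : ℕ) (u v : Fin K → EuclideanSpace ℝ (Fin p)), P = ∑ k, outer (u k) (v k) →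
      hsInner A P ≤ c * ∑ k, θ (u k) (v k) := by
    intro K u v hP
    rw [hP, hsInner_sum_outer, Finset.mul_sum]
    exact Finset.sum_le_sum fun k _ => h _ _
  rcases hc.eq_or_lt with rfl | hc
  · rw [zero_mul, eq_sum_outer_single P, hsInner_sum_outer]
    exact Finset.sum_nonpos fun k _ => (h _ _).trans_eq (zero_mul _)
  · rw [← div_le_iff₀' hc]
    exact le_atomicNorm fun K u v hP => (div_le_iff₀' hc).2 (key K u v hP)

end Atomic

/-- The norm `‖u‖₂ + ‖u‖₁ / √s`, of which `theta s` is the tensor square. -/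
noncomputable def mixN (s : ℕ) (u : EuclideanSpace ℝ (Fin p)) : ℝ := ‖u‖ + l1Norm u / √(s : ℝ)

lemma theta_eq (s : ℕ) (u v : EuclideanSpace ℝ (Fin p)) : theta s u v = mixN s u * mixN s v := rfl

lemma l1Norm_nonneg (u : EuclideanSpace ℝ (Fin p)) : 0 ≤ l1Norm u :=
  Finset.sum_nonneg fun _ _ => abs_nonneg _

lemma l1Norm_smul (c : ℝ) (u : EuclideanSpace ℝ (Fin p)) : l1Norm (c • u) = |c| * l1Norm u := by
  simp [l1Norm, abs_mul, Finset.mul_sum]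

lemma mixN_nonneg (s : ℕ) (u : EuclideanSpace ℝ (Fin p)) : 0 ≤ mixN s u :=
  add_nonneg (norm_nonneg _) (div_nonneg (l1Norm_nonneg _) (Real.sqrt_nonneg _))

lemma mixN_smul (s : ℕ) (c : ℝ) (u : EuclideanSpace ℝ (Fin p)) :
    mixN s (c • u) = |c| * mixN s u := by
  rw [mixN, mixN, norm_smul, l1Norm_smul, Real.norm_eq_abs]; ring

lemma norm_le_mixN (s : ℕ) (u : EuclideanSpace ℝ (Fin p)) : ‖u‖ ≤ mixN s u :=
  le_add_of_nonneg_right (div_nonneg (l1Norm_nonneg _) (Real.sqrt_nonneg _))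

lemma theta_nonneg (s : ℕ) (u v : EuclideanSpace ℝ (Fin p)) : 0 ≤ theta s u v :=
  mul_nonneg (mixN_nonneg s u) (mixN_nonneg s v)

lemma theta_smul (s : ℕ) (c : ℝ) (u v : EuclideanSpace ℝ (Fin p)) :
    theta s (c • u) v = |c| * theta s u v := by
  rw [theta_eq, theta_eq, mixN_smul, mul_assoc]

lemma mixedNorm_outer_le (s : ℕ) (u v : EuclideanSpace ℝ (Fin p)) :
    mixedNorm s (outer u v) ≤ mixN s u * mixN s v := by
  refine (atomicNorm_le (theta_nonneg s) (ι := Unit) (fun _ => u) (fun _ => v) (by simp)).trans ?_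
  simp [theta_eq]

lemma nuclearNorm_outer_le (u v : EuclideanSpace ℝ (Fin p)) :
    nuclearNorm (outer u v) ≤ ‖u‖ * ‖v‖ := by
  refine (atomicNorm_le (fun _ _ => by positivity) (ι := Unit) (fun _ => u) (fun _ => v)
    (by simp)).trans ?_
  simp

lemma frobNorm_sq (A : Matrix (Fin p) (Fin p) ℝ) : frobNorm A ^ 2 = hsInner A A := by
  have h0 : (0 : ℝ) ≤ ∑ i, ∑ j, A i j ^ 2 :=
    Finset.sum_nonneg fun i _ => Finset.sum_nonneg fun j _ => sq_nonneg _
  rw [frobNorm, Real.sq_sqrt h0, hsInner_eq_sum]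
  simp only [sq]

lemma frobNorm_nonneg (A : Matrix (Fin p) (Fin p) ℝ) : 0 ≤ frobNorm A := Real.sqrt_nonneg _

/-- Cauchy–Schwarz for the Frobenius inner product with a rank-one matrix. -/
lemma abs_bilin_le_frobNorm (A : Matrix (Fin p) (Fin p) ℝ) (u v : EuclideanSpace ℝ (Fin p)) :
    |bilin A u v| ≤ frobNorm A * (‖u‖ * ‖v‖) := by
  have h : (bilin A u v) ^ 2 ≤ frobNorm A ^ 2 * (‖u‖ * ‖v‖) ^ 2 := by
    have h1 := Finset.sum_mul_sq_le_sq_mul_sq (Finset.univ : Finset (Fin p × Fin p))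
      (fun k => A k.1 k.2) (fun k => u k.1 * v k.2)
    rw [Fintype.sum_prod_type, Fintype.sum_prod_type, Fintype.sum_prod_type] at h1
    rw [frobNorm_sq, hsInner_eq_sum, mul_pow, EuclideanSpace.real_norm_sq_eq,
      EuclideanSpace.real_norm_sq_eq, Finset.sum_mul_sum, bilin_apply]
    simpa only [mul_pow, ← sq] using h1
  rw [← mul_pow] at h
  exact abs_le_of_sq_le_sq h (mul_nonneg (frobNorm_nonneg A) (by positivity))

lemma frobNorm_le_nuclearNorm (A : Matrix (Fin p) (Fin p) ℝ) : frobNorm A ≤ nuclearNorm A := by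
  have h := hsInner_le_atomicNorm (θ := fun u v => ‖u‖ * ‖v‖) (frobNorm_nonneg A) (A := A)
    (fun u v => (le_abs_self _).trans (abs_bilin_le_frobNorm A u v)) A
  rw [← frobNorm_sq, sq] at h
  rcases (frobNorm_nonneg A).eq_or_lt with h0 | h0
  · rw [← h0]; exact atomicNorm_nonneg (fun _ _ => by positivity) A
  · exact le_of_mul_le_mul_left h h0

lemma abs_apply_le_frobNorm (A : Matrix (Fin p) (Fin p) ℝ) (i j : Fin p) :
    |A i j| ≤ frobNorm A := by
  refine Real.abs_le_sqrt ?_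
  refine (Finset.single_le_sum (f := fun j => A i j ^ 2) (fun _ _ => sq_nonneg _)
    (Finset.mem_univ j)).trans ?_
  exact Finset.single_le_sum (f := fun i => ∑ j, A i j ^ 2)
    (fun _ _ => Finset.sum_nonneg fun _ _ => sq_nonneg _) (Finset.mem_univ i)

lemma continuous_nuclearNorm : Continuous (nuclearNorm : Matrix (Fin p) (Fin p) ℝ → ℝ) :=
  continuous_atomicNorm (θ := fun u v => ‖u‖ * ‖v‖) (fun _ _ => by positivity) fun c u v => by
    rw [norm_smul, Real.norm_eq_abs, mul_assoc]

lemma continuous_mixedNorm (s : ℕ) :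
    Continuous (mixedNorm s : Matrix (Fin p) (Fin p) ℝ → ℝ) :=
  continuous_atomicNorm (theta_nonneg s) (theta_smul s)

lemma isCompact_nuclearNorm_le_one :
    IsCompact {P : Matrix (Fin p) (Fin p) ℝ | nuclearNorm P ≤ 1} := by
  have hK : IsCompact (Set.pi Set.univ fun _ : Fin p => Set.pi Set.univ fun _ : Fin p =>
      Set.Icc (-1 : ℝ) 1) :=
    isCompact_univ_pi fun _ => isCompact_univ_pi fun _ => isCompact_Icc
  refine IsCompact.of_isClosed_subset (X := Fin p → Fin p → ℝ) hK
    (isClosed_le continuous_nuclearNorm continuous_const) ?_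
  intro P hP i _ j _
  exact abs_le.1 (((abs_apply_le_frobNorm P i j).trans (frobNorm_le_nuclearNorm P)).trans hP)

lemma exists_isPCASolution (s : ℕ) (lam : ℝ) (S : Matrix (Fin p) (Fin p) ℝ) :
    ∃ P, IsPCASolution s lam S P := by
  have hc : Continuous (pcaObjective s lam S) := by
    have : Continuous fun P : Matrix (Fin p) (Fin p) ℝ => hsInner S P :=
      (continuous_const.matrix_mul continuous_id).matrix_trace
    exact this.neg.add (continuous_const.mul (continuous_mixedNorm s))
  have hne : ({P : Matrix (Fin p) (Fin p) ℝ | nuclearNorm P ≤ 1}).Nonempty := by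
    refine ⟨0, ?_⟩
    have h := nuclearNorm_outer_le (0 : EuclideanSpace ℝ (Fin p)) 0
    have h0 : outer (0 : EuclideanSpace ℝ (Fin p)) 0 = 0 := by ext i j; simp [outer]
    rw [h0] at h
    simp only [norm_zero, mul_zero] at h
    exact h.trans zero_le_one
  obtain ⟨P, hP, hmin⟩ := isCompact_nuclearNorm_le_one.exists_isMinOn hne hc.continuousOn
  exact ⟨P, hP, fun Q hQ => hmin hQ⟩

/-! ### Decomposability of the mixed norm at a sparse rank-one matrix -/

/-- The component of `x` orthogonal to the unit vector `v`. -/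
noncomputable def perp (v x : EuclideanSpace ℝ (Fin p)) : EuclideanSpace ℝ (Fin p) := x - ⟪v, x⟫ • v

/-- `‖x_{Sᶜ}‖₁ / √s`, where `S` is the support of `v`. -/
noncomputable def offSupp (s : ℕ) (v x : EuclideanSpace ℝ (Fin p)) : ℝ :=
  (∑ i with v i = 0, |x i|) / √(s : ℝ)

/-- The vector of signs of `v` (zero off the support), divided by `√s`; it is a subgradient of `‖·‖₁ / √s` at `v`. -/
noncomputable def signVec (s : ℕ) (v : EuclideanSpace ℝ (Fin p)) : EuclideanSpace ℝ (Fin p) :=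
  WithLp.toLp 2 fun i => Real.sign (v i) / √(s : ℝ)

/-- For a unit vector `v`, a subgradient of `mixN s` at `v`. -/
noncomputable def subgrad (s : ℕ) (v : EuclideanSpace ℝ (Fin p)) : EuclideanSpace ℝ (Fin p) :=
  v + signVec s v

/-- The gauge `(‖Π x‖₂² + ‖x_{Sᶜ}‖₁² / s)^{1/2}` measuring how far an atom is from being
proportional to `v`. -/
noncomputable def devNorm (s : ℕ) (v x : EuclideanSpace ℝ (Fin p)) : ℝ :=
  √(‖perp v x‖ ^ 2 + offSupp s v x ^ 2)

lemma offSupp_nonneg (s : ℕ) (v x : EuclideanSpace ℝ (Fin p)) : 0 ≤ offSupp s v x :=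
  div_nonneg (Finset.sum_nonneg fun _ _ => abs_nonneg _) (Real.sqrt_nonneg _)

lemma offSupp_add_le (s : ℕ) (v x y : EuclideanSpace ℝ (Fin p)) :
    offSupp s v (x + y) ≤ offSupp s v x + offSupp s v y := by
  rw [offSupp, offSupp, offSupp, ← add_div, ← Finset.sum_add_distrib]
  gcongr
  exact abs_add_le _ _

lemma offSupp_smul (s : ℕ) (v x : EuclideanSpace ℝ (Fin p)) (c : ℝ) :
    offSupp s v (c • x) = |c| * offSupp s v x := by
  simp [offSupp, abs_mul, Finset.mul_sum, mul_div_assoc, Finset.sum_div]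

lemma offSupp_sum_le {ι : Type*} (t : Finset ι) (s : ℕ) (v : EuclideanSpace ℝ (Fin p))
    (x : ι → EuclideanSpace ℝ (Fin p)) :
    offSupp s v (∑ k ∈ t, x k) ≤ ∑ k ∈ t, offSupp s v (x k) := by
  classical
  induction t using Finset.induction_on with
  | empty => simp [offSupp]
  | insert a t ha ih =>
    rw [Finset.sum_insert ha, Finset.sum_insert ha]
    exact (offSupp_add_le _ _ _ _).trans (by gcongr)

lemma perp_add (v x y : EuclideanSpace ℝ (Fin p)) : perp v (x + y) = perp v x + perp v y := by
  simp only [perp, inner_add_right, add_smul]; abel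

lemma perp_smul (v x : EuclideanSpace ℝ (Fin p)) (c : ℝ) : perp v (c • x) = c • perp v x := by
  simp only [perp, inner_smul_right, smul_sub, smul_smul]

lemma eq_smul_add_perp (v x : EuclideanSpace ℝ (Fin p)) : x = ⟪v, x⟫ • v + perp v x := by
  simp [perp]

section Unit

variable {s : ℕ} {v : EuclideanSpace ℝ (Fin p)} (hv : ‖v‖ = 1)

include hv

lemma inner_perp (x : EuclideanSpace ℝ (Fin p)) : ⟪v, perp v x⟫ = 0 := by
  rw [perp, inner_sub_right, inner_smul_right, real_inner_self_eq_norm_sq, hv]; ring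

lemma norm_perp_sq (x : EuclideanSpace ℝ (Fin p)) : ‖perp v x‖ ^ 2 = ‖x‖ ^ 2 - ⟪v, x⟫ ^ 2 := by
  rw [perp, norm_sub_sq_real, inner_smul_right, norm_smul, hv, real_inner_comm, Real.norm_eq_abs,
    mul_one, sq_abs]
  ring

lemma inner_self_perp (x : EuclideanSpace ℝ (Fin p)) : ⟪x, perp v x⟫ = ‖perp v x‖ ^ 2 := by
  conv_lhs => rw [eq_smul_add_perp v x]
  rw [perp_add, perp_smul]
  have h0 : perp v v = 0 := by simp [perp, hv]
  have h1 : perp v (perp v x) = perp v x := by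
    conv_lhs => rw [perp, inner_perp hv]
    simp
  rw [h0, h1, smul_zero, zero_add, inner_add_left, inner_smul_left, inner_perp hv,
    real_inner_self_eq_norm_sq]
  simp

variable (hsp : IsSparse s v)

omit hv in
include hsp in
lemma IsSparse.card_le : ((Finset.univ.filter fun i => v i ≠ 0).card : ℝ) ≤ s := by
  have h : (Finset.univ.filter fun i => v i ≠ 0).card ≤ s := by
    have h := hsp
    rw [IsSparse, Set.ncard_eq_toFinset_card'] at h
    simpa using h
  exact_mod_cast h

omit hv in
include hsp in
lemma sum_supp_abs_le (x : EuclideanSpace ℝ (Fin p)) :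
    ∑ i with v i ≠ 0, |x i| ≤ √(s : ℝ) * ‖x‖ := by
  refine Real.le_sqrt_of_sq_le ?_ |>.trans_eq (show √((s : ℝ) * ‖x‖ ^ 2) = _ by
    rw [Real.sqrt_mul (Nat.cast_nonneg s), Real.sqrt_sq (norm_nonneg x)])
  refine (sq_sum_le_card_mul_sum_sq (s := Finset.univ.filter fun i => v i ≠ 0)
    (f := fun i => |x i|)).trans ?_
  rw [EuclideanSpace.real_norm_sq_eq]
  have h2 : ∑ i with v i ≠ 0, |x i| ^ 2 ≤ ∑ i, x i ^ 2 := by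
    simp only [sq_abs]
    exact Finset.sum_le_sum_of_subset_of_nonneg (Finset.filter_subset _ _)
      fun _ _ _ => sq_nonneg _
  exact mul_le_mul hsp.card_le h2 (Finset.sum_nonneg fun _ _ => by positivity) (Nat.cast_nonneg s)

omit hv in
lemma l1Norm_eq (x : EuclideanSpace ℝ (Fin p)) :
    l1Norm x / √(s : ℝ) = (∑ i with v i ≠ 0, |x i|) / √(s : ℝ) + offSupp s v x := by
  rw [offSupp, ← add_div, l1Norm, add_comm,
    Finset.sum_filter_add_sum_filter_not (Finset.univ) (fun i => v i = 0) fun i => |x i|]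

omit hv in
lemma abs_inner_signVec_le (x : EuclideanSpace ℝ (Fin p)) :
    |⟪signVec s v, x⟫| ≤ (∑ i with v i ≠ 0, |x i|) / √(s : ℝ) := by
  rw [inner_eq_sum, Finset.sum_filter, Finset.sum_div]
  refine (Finset.abs_sum_le_sum_abs _ _).trans (Finset.sum_le_sum fun i _ => ?_)
  simp only [signVec]
  split_ifs with h
  · rw [div_mul_eq_mul_div, abs_div, abs_mul, abs_of_nonneg (Real.sqrt_nonneg _)]
    gcongr
    rcases Real.sign_apply_eq_of_ne_zero (v i) h with h | h <;> simp [h]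
  · have h' : v i = 0 := not_not.1 h
    simp [h']

omit hv in
lemma inner_signVec_self : ⟪signVec s v, v⟫ = l1Norm v / √(s : ℝ) := by
  rw [inner_eq_sum, l1Norm, Finset.sum_div]
  refine Finset.sum_congr rfl fun i _ => ?_
  simp only [signVec]
  rw [div_mul_eq_mul_div]
  congr 1
  rcases lt_trichotomy (v i) 0 with h | h | h
  · rw [Real.sign_of_neg h, abs_of_neg h]; ring
  · simp [h]
  · rw [Real.sign_of_pos h, abs_of_pos h]; ring

variable (hs : 1 ≤ s)

omit hv in
include hsp hs in
lemma sum_supp_abs_div_le (x : EuclideanSpace ℝ (Fin p)) :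
    (∑ i with v i ≠ 0, |x i|) / √(s : ℝ) ≤ ‖x‖ := by
  have hs' : 0 < √(s : ℝ) := Real.sqrt_pos.2 (by exact_mod_cast hs)
  rw [div_le_iff₀' hs']
  exact sum_supp_abs_le hsp x

include hsp hs in
lemma norm_subgrad_le : ‖subgrad s v‖ ≤ 2 := by
  have h1 : ‖signVec s v‖ ≤ 1 := by
    have h := (abs_inner_signVec_le (s := s) (v := v) (signVec s v)).trans
      (sum_supp_abs_div_le hsp hs _)
    rw [real_inner_self_eq_norm_sq, abs_of_nonneg (sq_nonneg _)] at h
    nlinarith [norm_nonneg (signVec s v)]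
  have := norm_add_le v (signVec s v)
  rw [subgrad]; linarith

lemma inner_subgrad_self : ⟪subgrad s v, v⟫ = mixN s v := by
  rw [subgrad, inner_add_left, inner_signVec_self, real_inner_self_eq_norm_sq, mixN, hv]; norm_num

include hsp hs in
lemma mixN_le_two : mixN s v ≤ 2 := by
  have h := sum_supp_abs_div_le hsp hs v
  have h0 : offSupp s v v = 0 := by
    rw [offSupp, Finset.sum_eq_zero, zero_div]
    intro i hi
    simp [(Finset.mem_filter.1 hi).2]
  rw [mixN, l1Norm_eq (v := v), h0, hv]
  rw [hv] at h
  linarith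

lemma abs_inner_subgrad_add_le (x : EuclideanSpace ℝ (Fin p)) :
    |⟪subgrad s v, x⟫| + offSupp s v x ≤ mixN s x := by
  have h1 := abs_inner_signVec_le (s := s) (v := v) x
  have h2 : |⟪v, x⟫| ≤ ‖x‖ := by simpa [hv] using abs_real_inner_le_norm v x
  have h3 := abs_add_le ⟪v, x⟫ ⟪signVec s v, x⟫
  rw [subgrad, inner_add_left, mixN, l1Norm_eq (v := v)]
  linarith

lemma inner_subgrad_sq_add_le (x : EuclideanSpace ℝ (Fin p)) :
    ⟪subgrad s v, x⟫ ^ 2 + devNorm s v x ^ 2 ≤ mixN s x ^ 2 := by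
  have h1 := abs_inner_signVec_le (s := s) (v := v) x
  have h2 : |⟪v, x⟫| ≤ ‖x‖ := by simpa [hv] using abs_real_inner_le_norm v x
  have h3 := abs_add_le ⟪v, x⟫ ⟪signVec s v, x⟫
  have h4 := offSupp_nonneg s v x
  rw [devNorm, Real.sq_sqrt (by positivity), norm_perp_sq hv]
  rw [subgrad, inner_add_left, mixN, l1Norm_eq (v := v), ← sq_abs (⟪v, x⟫ + _), ← sq_abs ⟪v, x⟫]
  generalize (∑ i with v i ≠ 0, |x i|) / √(s : ℝ) = b at *
  have h5 := abs_nonneg ⟪v, x⟫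
  have h6 := abs_nonneg ⟪signVec s v, x⟫
  have h7 : |⟪v, x⟫ + ⟪signVec s v, x⟫| ^ 2 ≤ (|⟪v, x⟫| + b) ^ 2 :=
    pow_le_pow_left₀ (abs_nonneg _) (by linarith) 2
  have h8 : 0 ≤ b := h6.trans h1
  nlinarith [mul_nonneg h8 (sub_nonneg.2 h2), mul_nonneg h8 h4, mul_nonneg h4 (norm_nonneg x)]

omit hv in
lemma devNorm_nonneg (x : EuclideanSpace ℝ (Fin p)) : 0 ≤ devNorm s v x := Real.sqrt_nonneg _

omit hv in
lemma norm_perp_le_devNorm (x : EuclideanSpace ℝ (Fin p)) : ‖perp v x‖ ≤ devNorm s v x :=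
  Real.le_sqrt_of_sq_le (le_add_of_nonneg_right (sq_nonneg _))

omit hv in
lemma offSupp_le_devNorm (x : EuclideanSpace ℝ (Fin p)) : offSupp s v x ≤ devNorm s v x :=
  Real.le_sqrt_of_sq_le (le_add_of_nonneg_left (sq_nonneg _))

omit hv in
include hsp hs in
lemma mixN_perp_le (x : EuclideanSpace ℝ (Fin p)) :
    mixN s (perp v x) ≤ 2 * ‖perp v x‖ + offSupp s v x := by
  have h := sum_supp_abs_div_le hsp hs (perp v x)
  have h0 : offSupp s v (perp v x) = offSupp s v x := by
    rw [offSupp, offSupp]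
    congr 1
    refine Finset.sum_congr rfl fun i hi => ?_
    simp [perp, (Finset.mem_filter.1 hi).2]
  rw [mixN, l1Norm_eq (v := v), h0]
  linarith

omit hv in
include hsp hs in
lemma mixN_perp_le_devNorm (x : EuclideanSpace ℝ (Fin p)) :
    mixN s (perp v x) ≤ 3 * devNorm s v x := by
  have h1 := mixN_perp_le hsp hs x
  have h2 := norm_perp_le_devNorm (s := s) (v := v) x
  have h3 := offSupp_le_devNorm (s := s) (v := v) x
  linarith

/-- The excess of the cost of an atom over its pairing with the subgradient `w ⊗ w` of the mixed
norm at `v ⊗ v` controls the part of the atom that is transversal to `v ⊗ v`. -/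
lemma atom_excess (x y : EuclideanSpace ℝ (Fin p)) :
    devNorm s v x * devNorm s v y + |⟪subgrad s v, x⟫| * offSupp s v y
      + offSupp s v x * |⟪subgrad s v, y⟫| ≤
      3 * (theta s x y - ⟪subgrad s v, x⟫ * ⟪subgrad s v, y⟫) := by
  have hx := abs_inner_subgrad_add_le (s := s) hv x
  have hy := abs_inner_subgrad_add_le (s := s) hv y
  have hx2 := inner_subgrad_sq_add_le (s := s) hv x
  have hy2 := inner_subgrad_sq_add_le (s := s) hv y
  rw [theta_eq]
  have tx := offSupp_nonneg s v x
  have ty := offSupp_nonneg s v y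
  have nx := mixN_nonneg s x
  have ny := mixN_nonneg s y
  generalize ⟪subgrad s v, x⟫ = a at *
  generalize ⟪subgrad s v, y⟫ = b at *
  generalize devNorm s v x = M at *
  generalize devNorm s v y = M' at *
  generalize mixN s x = N at *
  generalize mixN s y = N' at *
  generalize offSupp s v x = t at *
  generalize offSupp s v y = t' at *
  have hab : a * b ≤ |a| * |b| := by rw [← abs_mul]; exact le_abs_self _
  have ha := abs_nonneg a
  have hb := abs_nonneg b
  have h1 : |a| * |b| + |a| * t' ≤ N * N' := by
    rw [← mul_add]
    exact mul_le_mul (by linarith) hy (by positivity) nx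
  have h2 : |a| * |b| + t * |b| ≤ N * N' := by
    rw [← add_mul]
    exact mul_le_mul hx (by linarith) (by positivity) nx
  have h3 : a * b + M * M' ≤ N * N' := by
    refine (le_abs_self _).trans (abs_le_of_sq_le_sq ?_ (mul_nonneg nx ny))
    calc (a * b + M * M') ^ 2 ≤ (a ^ 2 + M ^ 2) * (b ^ 2 + M' ^ 2) := by
          nlinarith [sq_nonneg (a * M' - M * b)]
      _ ≤ N ^ 2 * N' ^ 2 := by gcongr
      _ = (N * N') ^ 2 := by ring
  linarith

/-- Control of the cross terms `v ⊗ b`, with `b = β ∘ Π`, on an atomic decomposition. The pairing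
with `v` is first replaced by one with the subgradient `w`, whose cost the excess pays for. -/
lemma abs_sum_cross_le {ι : Type*} [Fintype ι] (x y : ι → EuclideanSpace ℝ (Fin p))
    (β : EuclideanSpace ℝ (Fin p) →ₗ[ℝ] ℝ) {η D : ℝ} (hη : 0 ≤ η) (hD : 0 ≤ D)
    (hβ : ∀ u, ⟪v, u⟫ = 0 → |β u| ≤ η * mixN s u)
    (hxy : ∀ q, ⟪v, q⟫ = 0 → |∑ k, ⟪subgrad s v, x k⟫ * ⟪y k, q⟫| ≤ D * ‖q‖)
    (hsp : IsSparse s v) (hs : 1 ≤ s) :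
    |∑ k, ⟪v, x k⟫ * β (perp v (y k))| ≤ η * (2 * D
      + ∑ k, |⟪subgrad s v, x k⟫| * offSupp s v (y k)
      + 3 * ∑ k, devNorm s v (x k) * devNorm s v (y k)) := by
  set w := subgrad s v with hw
  set z := ∑ k, ⟪w, x k⟫ • y k with hz
  have hN : 1 ≤ mixN s v := by rw [← hv]; exact norm_le_mixN s v
  have hperp_sum : perp v z = ∑ k, ⟪w, x k⟫ • perp v (y k) := by
    rw [hz]
    simp only [perp, inner_sum, inner_smul_right, smul_sub, Finset.sum_sub_distrib, smul_smul,
      Finset.sum_smul]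
  have hsplit : mixN s v * ∑ k, ⟪v, x k⟫ * β (perp v (y k)) =
      β (perp v z) - ∑ k, ⟪w, perp v (x k)⟫ * β (perp v (y k)) := by
    rw [hperp_sum, map_sum, Finset.mul_sum, ← Finset.sum_sub_distrib]
    refine Finset.sum_congr rfl fun k _ => ?_
    have : ⟪w, x k⟫ = ⟪v, x k⟫ * mixN s v + ⟪w, perp v (x k)⟫ := by
      conv_lhs => rw [eq_smul_add_perp v (x k)]
      rw [inner_add_right, inner_smul_right, hw, inner_subgrad_self hv]
    rw [map_smul, this, smul_eq_mul]; ring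
  have hzD : ‖perp v z‖ ≤ D := by
    have h1 : ‖perp v z‖ ^ 2 ≤ D * ‖perp v z‖ := by
      rw [← inner_self_perp hv z]
      have h2 := hxy (perp v z) (inner_perp hv z)
      have h3 : ⟪z, perp v z⟫ = ∑ k, ⟪w, x k⟫ * ⟪y k, perp v z⟫ := by
        conv_lhs => rw [hz]
        rw [sum_inner]
        exact Finset.sum_congr rfl fun k _ => by rw [real_inner_smul_left]
      rw [h3]
      exact (le_abs_self _).trans h2
    rcases (norm_nonneg (perp v z)).eq_or_lt with h0 | h0
    · rw [← h0]; exact hD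
    · rw [sq] at h1; exact le_of_mul_le_mul_right h1 h0
  have hoff : offSupp s v z ≤ ∑ k, |⟪w, x k⟫| * offSupp s v (y k) := by
    refine (offSupp_sum_le _ _ _ _).trans_eq ?_
    simp only [offSupp_smul]
  have hA : |β (perp v z)| ≤ η * (2 * D + ∑ k, |⟪w, x k⟫| * offSupp s v (y k)) := by
    refine (hβ _ (inner_perp hv z)).trans (mul_le_mul_of_nonneg_left ?_ hη)
    have := mixN_perp_le hsp hs z
    linarith
  have hB : |∑ k, ⟪w, perp v (x k)⟫ * β (perp v (y k))| ≤
      η * (3 * ∑ k, devNorm s v (x k) * devNorm s v (y k)) := by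
    rw [Finset.mul_sum, Finset.mul_sum]
    refine (Finset.abs_sum_le_sum_abs _ _).trans (Finset.sum_le_sum fun k _ => ?_)
    have h1 : |⟪w, perp v (x k)⟫| ≤ devNorm s v (x k) := by
      rw [hw, subgrad, inner_add_left, inner_perp hv, zero_add]
      exact (abs_inner_signVec_le _).trans
        ((sum_supp_abs_div_le hsp hs _).trans (norm_perp_le_devNorm _))
    have h2 : |β (perp v (y k))| ≤ η * (3 * devNorm s v (y k)) :=
      (hβ _ (inner_perp hv _)).trans
        (mul_le_mul_of_nonneg_left (mixN_perp_le_devNorm hsp hs _) hη)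
    rw [abs_mul]
    calc _ ≤ devNorm s v (x k) * (η * (3 * devNorm s v (y k))) :=
          mul_le_mul h1 h2 (abs_nonneg _) (devNorm_nonneg _)
      _ = _ := by ring
  have hC : |∑ k, ⟪v, x k⟫ * β (perp v (y k))| ≤
      |mixN s v * ∑ k, ⟪v, x k⟫ * β (perp v (y k))| := by
    rw [abs_mul, abs_of_nonneg (mixN_nonneg s v)]
    exact le_mul_of_one_le_left (abs_nonneg _) hN
  rw [hsplit] at hC
  have := abs_sub (β (perp v z)) (∑ k, ⟪w, perp v (x k)⟫ * β (perp v (y k)))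
  linarith

end Unit

/-! ### The deterministic error bound -/

section Deterministic

variable {s : ℕ} {v : EuclideanSpace ℝ (Fin p)} {S Sig₂ : Matrix (Fin p) (Fin p) ℝ}

lemma bilin_right_eq_zero {A : Matrix (Fin p) (Fin p) ℝ} {v : EuclideanSpace ℝ (Fin p)}
    (h : A.mulVec v = 0) (u : EuclideanSpace ℝ (Fin p)) : bilin A u v = 0 := by
  rw [bilin_apply]
  refine Finset.sum_eq_zero fun i _ => ?_
  have h1 : ∑ j, A i j * v j = 0 := by simpa [Matrix.mulVec, dotProduct] using congrFun h i
  calc ∑ j, A i j * (u i * v j) = u i * ∑ j, A i j * v j := by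
        rw [Finset.mul_sum]; exact Finset.sum_congr rfl fun j _ => by ring
    _ = 0 := by rw [h1, mul_zero]

/-- Splitting both arguments of a symmetric form along `v` and its orthogonal complement. -/
lemma bilin_split {A : Matrix (Fin p) (Fin p) ℝ} (hA : A.transpose = A)
    (x y : EuclideanSpace ℝ (Fin p)) :
    bilin A x y = bilin A v v * (⟪v, x⟫ * ⟪v, y⟫) + ⟪v, x⟫ * bilin A v (perp v y)
      + ⟪v, y⟫ * bilin A v (perp v x) + bilin A (perp v x) (perp v y) := by
  conv_lhs => rw [eq_smul_add_perp v x, eq_smul_add_perp v y]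
  simp only [map_add, map_smul, LinearMap.add_apply, LinearMap.smul_apply, smul_eq_mul]
  rw [bilin_symm hA (perp v x) v]
  ring

lemma bilin_perp_perp (hsymm : Sig₂.transpose = Sig₂) (hSv : Sig₂.mulVec v = 0)
    (x y : EuclideanSpace ℝ (Fin p)) :
    bilin Sig₂ x y = bilin Sig₂ (perp v x) (perp v y) := by
  rw [bilin_split (v := v) hsymm, bilin_right_eq_zero hSv,
    bilin_symm hsymm v (perp v x), bilin_symm hsymm v (perp v y),
    bilin_right_eq_zero hSv, bilin_right_eq_zero hSv]
  ring

/-- The noise `S - (vᵀ S v) v ⊗ v - Σ₂` pairs with `P` to at most the Frobenius error plus the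
excess of the mixed norm of `P` over its linearization at `v ⊗ v`. -/
lemma noise_le (hs : 1 ≤ s) (hv : ‖v‖ = 1) (hsp : IsSparse s v) {η : ℝ} (hη : 0 ≤ η)
    (hS : S.transpose = S) (hSig : Sig₂.transpose = Sig₂) (hSv : Sig₂.mulVec v = 0)
    (hcross : ∀ u, ⟪v, u⟫ = 0 → |bilin S v u| ≤ η * mixN s u)
    (hperp : ∀ u u', ⟪v, u⟫ = 0 → ⟪v, u'⟫ = 0 →
      |bilin S u u' - bilin Sig₂ u u'| ≤ η * (mixN s u * mixN s u'))
    (P : Matrix (Fin p) (Fin p) ℝ) :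
    hsInner S P - bilin S v v * bilin P v v - hsInner Sig₂ P ≤
      η * (8 * frobNorm (P - outer v v)
        + 45 * (mixedNorm s P - bilin P (subgrad s v) (subgrad s v))) := by
  set δ := P - outer v v with hδ
  set w := subgrad s v with hw
  have hw2 : ‖w‖ ≤ 2 := norm_subgrad_le hv hsp hs
  have key : ∀ (K : ℕ) (x y : Fin K → EuclideanSpace ℝ (Fin p)), P = ∑ k, outer (x k) (y k) →
      hsInner S P - bilin S v v * bilin P v v - hsInner Sig₂ P ≤
      η * (8 * frobNorm δ + 45 * (∑ k, theta s (x k) (y k) - bilin P w w)) := by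
    intro K x y hP
    have hb : ∀ a b, bilin P a b = ∑ k, ⟪x k, a⟫ * ⟪y k, b⟫ := by
      intro a b
      rw [← hsInner_outer_left, hP, hsInner_sum_outer]
      simp only [bilin_outer, real_inner_comm]
    -- On the complement of `v`, pairings with `w` see only the deviation `δ`.
    have hxy : ∀ q, ⟪v, q⟫ = 0 → |∑ k, ⟪w, x k⟫ * ⟪y k, q⟫| ≤ 2 * frobNorm δ * ‖q‖ := by
      intro q hq
      have h1 : ∑ k, ⟪w, x k⟫ * ⟪y k, q⟫ = bilin δ w q := by
        rw [hδ, bilin_sub, bilin_outer, hq, mul_zero, sub_zero, hb]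
        exact Finset.sum_congr rfl fun k _ => by rw [real_inner_comm]
      rw [h1]
      refine (abs_bilin_le_frobNorm _ _ _).trans ?_
      have := mul_le_mul_of_nonneg_right hw2 (norm_nonneg q)
      nlinarith [frobNorm_nonneg δ]
    have hyx : ∀ q, ⟪v, q⟫ = 0 → |∑ k, ⟪w, y k⟫ * ⟪x k, q⟫| ≤ 2 * frobNorm δ * ‖q‖ := by
      intro q hq
      have h1 : ∑ k, ⟪w, y k⟫ * ⟪x k, q⟫ = bilin δ q w := by
        rw [hδ, bilin_sub, bilin_outer, hq, zero_mul, sub_zero, hb]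
        exact Finset.sum_congr rfl fun k _ => by rw [real_inner_comm, mul_comm]
      rw [h1]
      refine (abs_bilin_le_frobNorm _ _ _).trans ?_
      have := mul_le_mul_of_nonneg_right hw2 (norm_nonneg q)
      nlinarith [frobNorm_nonneg δ]
    have hD : 0 ≤ 2 * frobNorm δ := mul_nonneg zero_le_two (frobNorm_nonneg δ)
    have c1 := abs_sum_cross_le hv x y (bilin S v) hη hD hcross hxy hsp hs
    have c2 := abs_sum_cross_le hv y x (bilin S v) hη hD hcross hyx hsp hs
    have c3 : ∑ k, (bilin S (perp v (x k)) (perp v (y k)) -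
        bilin Sig₂ (perp v (x k)) (perp v (y k))) ≤
        η * (9 * ∑ k, devNorm s v (x k) * devNorm s v (y k)) := by
      rw [Finset.mul_sum, Finset.mul_sum]
      refine Finset.sum_le_sum fun k _ => (le_abs_self _).trans
        ((hperp _ _ (inner_perp hv _) (inner_perp hv _)).trans
          (mul_le_mul_of_nonneg_left ?_ hη))
      calc _ ≤ (3 * devNorm s v (x k)) * (3 * devNorm s v (y k)) :=
            mul_le_mul (mixN_perp_le_devNorm hsp hs _) (mixN_perp_le_devNorm hsp hs _)
              (mixN_nonneg _ _) (mul_nonneg zero_le_three (devNorm_nonneg _))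
        _ = _ := by ring
    have hdec : hsInner S P - bilin S v v * bilin P v v - hsInner Sig₂ P =
        ∑ k, ⟪v, x k⟫ * bilin S v (perp v (y k)) + ∑ k, ⟪v, y k⟫ * bilin S v (perp v (x k))
        + ∑ k, (bilin S (perp v (x k)) (perp v (y k)) -
          bilin Sig₂ (perp v (x k)) (perp v (y k))) := by
      rw [hb, hP, hsInner_sum_outer, hsInner_sum_outer, Finset.mul_sum, ← Finset.sum_sub_distrib,
        ← Finset.sum_sub_distrib, ← Finset.sum_add_distrib, ← Finset.sum_add_distrib]
      refine Finset.sum_congr rfl fun k _ => ?_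
      rw [bilin_split (v := v) hS, bilin_perp_perp hSig hSv, real_inner_comm v (x k),
        real_inner_comm v (y k)]
      ring
    have hex : ∑ k, devNorm s v (x k) * devNorm s v (y k)
        + ∑ k, |⟪w, x k⟫| * offSupp s v (y k) + ∑ k, |⟪w, y k⟫| * offSupp s v (x k) ≤
        3 * (∑ k, theta s (x k) (y k) - bilin P w w) := by
      rw [hb, ← Finset.sum_sub_distrib, ← Finset.sum_add_distrib, ← Finset.sum_add_distrib,
        Finset.mul_sum]
      refine Finset.sum_le_sum fun k _ => ?_
      have := atom_excess (s := s) hv (x k) (y k)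
      rw [← hw] at this
      rw [real_inner_comm w (x k), real_inner_comm w (y k), mul_comm |⟪w, y k⟫|]
      exact this
    have c1' := (le_abs_self _).trans c1
    have c2' := (le_abs_self _).trans c2
    simp only [mul_comm (devNorm s v (y _))] at c2'
    rw [hdec]
    refine (add_le_add (add_le_add c1' c2') c3).trans ?_
    rw [← mul_add, ← mul_add]
    refine mul_le_mul_of_nonneg_left ?_ hη
    have n1 : 0 ≤ ∑ k, |⟪w, x k⟫| * offSupp s v (y k) :=
      Finset.sum_nonneg fun k _ => mul_nonneg (abs_nonneg _) (offSupp_nonneg _ _ _)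
    have n2 : 0 ≤ ∑ k, |⟪w, y k⟫| * offSupp s v (x k) :=
      Finset.sum_nonneg fun k _ => mul_nonneg (abs_nonneg _) (offSupp_nonneg _ _ _)
    linarith
  rcases hη.eq_or_lt with h0 | h0
  · obtain ⟨K, x, y, hP⟩ : ∃ (K : ℕ) (x y : Fin K → EuclideanSpace ℝ (Fin p)),
        P = ∑ k, outer (x k) (y k) :=
      ⟨_, _, _, (eq_sum_outer_single P).trans
        (Equiv.sum_comp (Fintype.equivFin (Fin p × Fin p)).symm _).symm⟩
    have := key K x y hP
    rw [← h0, zero_mul] at this ⊢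
    exact this
  · have h1 : ((hsInner S P - bilin S v v * bilin P v v - hsInner Sig₂ P) / η - 8 * frobNorm δ)
        / 45 + bilin P w w ≤ mixedNorm s P := by
      refine le_atomicNorm fun K x y hP => ?_
      have := key K x y hP
      rw [← div_le_iff₀' h0] at this
      linarith
    rw [← div_le_iff₀' h0]
    linarith

/-- `⟨Σ₂, P⟩ ≤ σ₂ (1 - vᵀ P v)` on the nuclear norm ball, since `σ₂ v ⊗ v + Σ₂` has spectral norm
at most `σ₂`. -/
lemma hsInner_le_opNorm_mul (hv : ‖v‖ = 1) (hSig : Sig₂.transpose = Sig₂)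
    (hSv : Sig₂.mulVec v = 0) {P : Matrix (Fin p) (Fin p) ℝ} (hP : nuclearNorm P ≤ 1) :
    hsInner Sig₂ P ≤ opNorm Sig₂ * (1 - bilin P v v) := by
  have h0 : 0 ≤ opNorm Sig₂ := norm_nonneg _
  have h : ∀ x y, bilin (opNorm Sig₂ • outer v v + Sig₂) x y ≤ opNorm Sig₂ * (‖x‖ * ‖y‖) := by
    intro x y
    rw [bilin_add, bilin_smul, bilin_outer, bilin_perp_perp hSig hSv]
    have h2 := (le_abs_self _).trans (abs_bilin_le_opNorm Sig₂ (perp v x) (perp v y))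
    have h3 : ⟪v, x⟫ * ⟪v, y⟫ + ‖perp v x‖ * ‖perp v y‖ ≤ ‖x‖ * ‖y‖ := by
      have hx := norm_perp_sq hv x
      have hy := norm_perp_sq hv y
      refine (le_abs_self _).trans (abs_le_of_sq_le_sq ?_ (by positivity))
      have e : (‖x‖ * ‖y‖) ^ 2 =
          (⟪v, x⟫ ^ 2 + ‖perp v x‖ ^ 2) * (⟪v, y⟫ ^ 2 + ‖perp v y‖ ^ 2) := by
        rw [hx, hy]; ring
      rw [e]
      nlinarith [sq_nonneg (⟪v, x⟫ * ‖perp v y‖ - ‖perp v x‖ * ⟪v, y⟫)]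
    have h4 := mul_le_mul_of_nonneg_left h3 h0
    linarith
  have h5 := hsInner_le_atomicNorm (θ := fun u v => ‖u‖ * ‖v‖) h0 h P
  rw [hsInner_add_left, hsInner_smul_left, hsInner_outer_left] at h5
  have h6 := mul_le_mul_of_nonneg_left hP h0
  rw [nuclearNorm] at h6
  linarith

/-- On data satisfying the noise bounds, every solution is within `20 λ / gap` of `v ⊗ v`.

Comparing the objective at `P` and at `v ⊗ v`, the excess of the mixed norm absorbs the noise and
leaves `gap / 2 * (1 - vᵀ P v) ≤ 5 λ ‖P - v ⊗ v‖_F`. The left side is quadratic in the error because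
`‖P - v ⊗ v‖_F² ≤ 2 (1 - vᵀ P v)`, so one factor `‖P - v ⊗ v‖_F` cancels. -/
theorem frobNorm_sub_le (hs : 1 ≤ s) (hv : ‖v‖ = 1) (hsp : IsSparse s v) {η lam gap : ℝ}
    (hη : 0 ≤ η) (hlam : 45 * η ≤ lam) (hS : S.transpose = S) (hSig : Sig₂.transpose = Sig₂)
    (hSv : Sig₂.mulVec v = 0)
    (hcross : ∀ u, ⟪v, u⟫ = 0 → |bilin S v u| ≤ η * mixN s u)
    (hperp : ∀ u u', ⟪v, u⟫ = 0 → ⟪v, u'⟫ = 0 →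
      |bilin S u u' - bilin Sig₂ u u'| ≤ η * (mixN s u * mixN s u'))
    (hgap : 0 < gap) (hspike : opNorm Sig₂ + gap / 2 ≤ bilin S v v)
    {P : Matrix (Fin p) (Fin p) ℝ} (hP : IsPCASolution s lam S P) :
    frobNorm (P - outer v v) ≤ 20 * (lam / gap) := by
  obtain ⟨hP1, hmin⟩ := hP
  have hnoise := noise_le hs hv hsp hη hS hSig hSv hcross hperp P
  have hSig2 := hsInner_le_opNorm_mul hv hSig hSv hP1
  set δ := P - outer v v with hδ
  set w := subgrad s v with hw
  have hδ0 := frobNorm_nonneg δ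
  have hlam0 : 0 ≤ lam := (mul_nonneg (by norm_num) hη).trans hlam
  have hw2 : ‖w‖ ≤ 2 := norm_subgrad_le hv hsp hs
  have hvv : nuclearNorm (outer v v) ≤ 1 := (nuclearNorm_outer_le v v).trans (by rw [hv]; norm_num)
  have hbasic := hmin _ hvv
  rw [pcaObjective, pcaObjective, hsInner_outer] at hbasic
  have hmix : lam * mixedNorm s (outer v v) ≤ lam * (mixN s v * mixN s v) :=
    mul_le_mul_of_nonneg_left (mixedNorm_outer_le s v v) hlam0
  have hlin : bilin P w w = bilin δ w w + mixN s v * mixN s v := by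
    rw [hδ, bilin_sub, bilin_outer, real_inner_comm, hw, inner_subgrad_self hv]; ring
  have hδw : -(4 * frobNorm δ) ≤ bilin δ w w := by
    have h1 := (abs_le.1 (abs_bilin_le_frobNorm δ w w)).1
    have h2 : ‖w‖ * ‖w‖ ≤ 4 := by nlinarith [norm_nonneg w]
    nlinarith
  have hG : 0 ≤ mixedNorm s P - bilin P w w := by
    have h := hsInner_le_atomicNorm (θ := theta s) zero_le_one (A := outer w w) (fun x y => by
      rw [bilin_outer, one_mul]
      have h1 := atom_excess (s := s) hv x y
      have h2 := mul_nonneg (devNorm_nonneg (s := s) (v := v) x)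
        (devNorm_nonneg (s := s) (v := v) y)
      have h3 := mul_nonneg (abs_nonneg ⟪w, x⟫) (offSupp_nonneg s v y)
      have h4 := mul_nonneg (offSupp_nonneg s v x) (abs_nonneg ⟪w, y⟫)
      linarith) P
    rw [hsInner_outer_left, one_mul] at h
    rw [mixedNorm]
    linarith
  have hα : frobNorm δ ^ 2 ≤ 2 * (1 - bilin P v v) := by
    have h1 : frobNorm P ^ 2 ≤ 1 :=
      pow_le_one₀ (frobNorm_nonneg P) ((frobNorm_le_nuclearNorm P).trans hP1)
    have h2 : frobNorm δ ^ 2 = frobNorm P ^ 2 - 2 * bilin P v v + 1 := by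
      rw [frobNorm_sq, frobNorm_sq, hδ, hsInner_sub_left, hsInner_sub_right, hsInner_sub_right,
        hsInner_outer_left, hsInner_outer, hsInner_outer, bilin_outer,
        real_inner_self_eq_norm_sq, hv]
      ring
    linarith
  have hα0 : 0 ≤ 1 - bilin P v v := by nlinarith
  have hmain : (gap / 2) * (1 - bilin P v v) ≤ 5 * (lam * frobNorm δ) := by
    have e1 : lam * (bilin P w w) = lam * bilin δ w w + lam * (mixN s v * mixN s v) := by
      rw [hlin]; ring
    have e2 := mul_le_mul_of_nonneg_left hδw hlam0
    have e3 := mul_le_mul_of_nonneg_right hlam hδ0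
    have e4 := mul_le_mul_of_nonneg_right hlam hG
    have e5 := mul_le_mul_of_nonneg_right hspike hα0
    have e6 := mul_nonneg hη hδ0
    linarith
  rcases hδ0.eq_or_lt with h0 | h0
  · rw [← h0]; positivity
  · have h1 : frobNorm δ * (gap * frobNorm δ) ≤ frobNorm δ * (20 * lam) := by nlinarith
    have h2 := le_of_mul_le_mul_left h1 h0
    rw [← mul_div_assoc, le_div_iff₀ hgap]
    linarith

end Deterministic

/-! ### From integer vectors to sparse vectors to the mixed norm -/

lemma IsSparse.mono {s : ℕ} {u z : EuclideanSpace ℝ (Fin p)} (hu : IsSparse s u)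
    (h : ∀ i, u i = 0 → z i = 0) : IsSparse s z := by
  refine le_trans (Set.ncard_le_ncard ?_ (Set.toFinite _)) hu
  intro i hi hi'
  exact hi (h i hi')

/-- The coordinate projection of `u` onto the index set `T`. -/
noncomputable def restr (T : Finset (Fin p)) (u : EuclideanSpace ℝ (Fin p)) :
    EuclideanSpace ℝ (Fin p) :=
  WithLp.toLp 2 fun i => if i ∈ T then u i else 0

lemma restr_apply (T : Finset (Fin p)) (u : EuclideanSpace ℝ (Fin p)) (i : Fin p) :
    restr T u i = if i ∈ T then u i else 0 := rfl

lemma restr_add_restr_compl (T : Finset (Fin p)) (u : EuclideanSpace ℝ (Fin p)) :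
    restr T u + restr Tᶜ u = u := by
  ext i
  by_cases h : i ∈ T <;> simp [restr_apply, h]

lemma isSparse_restr {s : ℕ} {T : Finset (Fin p)} (hT : T.card ≤ s)
    (u : EuclideanSpace ℝ (Fin p)) : IsSparse s (restr T u) := by
  refine le_trans (Set.ncard_le_ncard (t := (T : Set (Fin p))) ?_ (Set.toFinite _)) ?_
  · intro i hi
    by_contra h
    exact hi (by simp [restr_apply, show i ∉ T from h])
  · rwa [Set.ncard_coe_finset]

lemma norm_restr_sq (T : Finset (Fin p)) (u : EuclideanSpace ℝ (Fin p)) :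
    ‖restr T u‖ ^ 2 = ∑ i ∈ T, u i ^ 2 := by
  rw [EuclideanSpace.real_norm_sq_eq]
  simp [restr_apply, ite_pow, Finset.sum_ite_mem]

lemma norm_restr_le (T : Finset (Fin p)) (u : EuclideanSpace ℝ (Fin p)) : ‖restr T u‖ ≤ ‖u‖ := by
  refine (sq_le_sq₀ (norm_nonneg _) (norm_nonneg _)).1 ?_
  rw [norm_restr_sq, EuclideanSpace.real_norm_sq_eq]
  exact Finset.sum_le_sum_of_subset_of_nonneg (Finset.subset_univ _) fun _ _ _ => sq_nonneg _

/-- The `s` largest entries of a nonnegative family. -/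
lemma exists_top_subset {s : ℕ} (hsp : s ≤ p) (a : Fin p → ℝ) :
    ∃ T : Finset (Fin p), T.card = s ∧ ∀ i ∈ T, ∀ j ∉ T, a j ≤ a i := by
  obtain ⟨T, hT, hmax⟩ := Finset.exists_max_image (Finset.powersetCard s Finset.univ)
    (fun T => ∑ i ∈ T, a i) (Finset.powersetCard_nonempty.2 (by simpa using hsp))
  rw [Finset.mem_powersetCard] at hT
  refine ⟨T, hT.2, fun i hi j hj => ?_⟩
  have hj' : j ∉ T.erase i := fun h => hj (Finset.mem_of_mem_erase h)
  have h := hmax (insert j (T.erase i)) (by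
    rw [Finset.mem_powersetCard, Finset.card_insert_of_notMem hj', Finset.card_erase_of_mem hi,
      hT.2]
    have : 0 < s := hT.2 ▸ Finset.card_pos.2 ⟨i, hi⟩
    exact ⟨Finset.subset_univ _, by omega⟩)
  rw [Finset.sum_insert hj', ← Finset.add_sum_erase T a hi] at h
  linarith

/-- A subadditive functional bounded by `c ‖·‖₂` on `s`-sparse vectors is bounded by `c` times the
mixed norm: split off the blocks of the `s` largest entries one after the other. -/
lemma le_mul_mixN_of_sparse {s : ℕ} (hs : 1 ≤ s) (hsp : s ≤ p) {c : ℝ} (hc : 0 ≤ c)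
    {f : EuclideanSpace ℝ (Fin p) → ℝ} (hf : ∀ u v, f (u + v) ≤ f u + f v)
    (hsparse : ∀ z, IsSparse s z → f z ≤ c * ‖z‖) (u : EuclideanSpace ℝ (Fin p)) :
    f u ≤ c * mixN s u := by
  have hs0 : (0 : ℝ) < s := by exact_mod_cast hs
  have hs' : 0 < √(s : ℝ) := Real.sqrt_pos.2 hs0
  suffices H : ∀ (n : ℕ) (u : EuclideanSpace ℝ (Fin p)),
      (Finset.univ.filter fun i => u i ≠ 0).card ≤ n →
      ∃ T : Finset (Fin p), T.card ≤ s ∧ f u ≤ c * (‖restr T u‖ + l1Norm u / √(s : ℝ)) by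
    obtain ⟨T, -, h⟩ := H _ u le_rfl
    refine h.trans (mul_le_mul_of_nonneg_left ?_ hc)
    rw [mixN]
    have := norm_restr_le T u
    linarith
  intro n
  induction n using Nat.strong_induction_on with
  | _ n ih =>
    intro u hn
    by_cases hcard : (Finset.univ.filter fun i => u i ≠ 0).card ≤ s
    · refine ⟨_, hcard, ?_⟩
      have hru : restr (Finset.univ.filter fun i => u i ≠ 0) u = u := by
        ext i
        by_cases h : u i = 0 <;> simp [restr_apply, h]
      rw [hru]
      have hu : IsSparse s u := by
        rw [← hru]; exact isSparse_restr hcard u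
      refine (hsparse u hu).trans (mul_le_mul_of_nonneg_left ?_ hc)
      exact norm_le_mixN s u
    · obtain ⟨T, hT, htop⟩ := exists_top_subset hsp fun i => |u i|
      push Not at hcard
      obtain ⟨j, hj, hjT⟩ := Finset.exists_mem_notMem_of_card_lt_card (hT.trans_lt hcard)
      have hj0 : 0 < |u j| := abs_pos.2 (Finset.mem_filter.1 hj).2
      obtain ⟨i, hi⟩ : T.Nonempty := Finset.card_pos.1 (by omega)
      have hi0 : u i ≠ 0 := abs_pos.1 (hj0.trans_le (htop i hi j hjT))
      have hlt : (Finset.univ.filter fun i => restr Tᶜ u i ≠ 0).card <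
          (Finset.univ.filter fun i => u i ≠ 0).card := by
        refine Finset.card_lt_card (Finset.ssubset_iff_of_subset ?_ |>.2 ⟨i, ?_, ?_⟩)
        · intro k hk
          have hk' := (Finset.mem_filter.1 hk).2
          refine Finset.mem_filter.2 ⟨Finset.mem_univ _, fun h => hk' ?_⟩
          simp [restr_apply, h]
        · simpa using hi0
        · simp [restr_apply, hi]
      obtain ⟨T', hT', hle⟩ := ih _ (hlt.trans_le hn) (restr Tᶜ u) le_rfl
      refine ⟨T, hT.le, ?_⟩
      have h1 : f u ≤ f (restr T u) + f (restr Tᶜ u) := by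
        conv_lhs => rw [← restr_add_restr_compl T u]
        exact hf _ _
      have h2 := hsparse _ (isSparse_restr hT.le u)
      have hl1 : l1Norm u = ∑ i ∈ T, |u i| + l1Norm (restr Tᶜ u) := by
        rw [l1Norm, l1Norm, ← Finset.sum_add_sum_compl T]
        congr 1
        rw [← Finset.sum_add_sum_compl T fun i => |restr Tᶜ u i|,
          Finset.sum_eq_zero (s := T), zero_add]
        · exact Finset.sum_congr rfl fun i hi => by
            simp [restr_apply, Finset.mem_compl.1 hi]
        · intro i hi
          simp [restr_apply, hi]
      -- Each entry outside `T` is at most the average of the entries in `T`.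
      have havg : ∀ k, |restr Tᶜ u k| ≤ (∑ i ∈ T, |u i|) / s := by
        intro k
        by_cases hk : k ∈ T
        · simp only [restr_apply, Finset.mem_compl, hk, not_true, if_false, abs_zero]
          exact div_nonneg (Finset.sum_nonneg fun _ _ => abs_nonneg _) hs0.le
        · simp only [restr_apply, Finset.mem_compl, hk, not_false_eq_true, if_true]
          rw [le_div_iff₀' hs0, ← hT, ← nsmul_eq_mul]
          exact Finset.card_nsmul_le_sum _ _ _ fun i hi => htop i hi k hk
      have h3 : ‖restr T' (restr Tᶜ u)‖ ≤ (∑ i ∈ T, |u i|) / √(s : ℝ) := by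
        have hnn : 0 ≤ (∑ i ∈ T, |u i|) / s := (abs_nonneg _).trans (havg i)
        refine (sq_le_sq₀ (norm_nonneg _)
          (div_nonneg (Finset.sum_nonneg fun _ _ => abs_nonneg _) hs'.le)).1 ?_
        rw [norm_restr_sq]
        calc ∑ k ∈ T', restr Tᶜ u k ^ 2 ≤ ∑ _k ∈ T', ((∑ i ∈ T, |u i|) / s) ^ 2 :=
              Finset.sum_le_sum fun k _ => by
                rw [← sq_abs]; exact pow_le_pow_left₀ (abs_nonneg _) (havg k) 2
          _ = T'.card * ((∑ i ∈ T, |u i|) / s) ^ 2 := by rw [Finset.sum_const, nsmul_eq_mul]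
          _ ≤ s * ((∑ i ∈ T, |u i|) / s) ^ 2 := by
              gcongr
          _ = ((∑ i ∈ T, |u i|) / √(s : ℝ)) ^ 2 := by
              rw [div_pow, div_pow, Real.sq_sqrt hs0.le]
              field_simp
      have h4 : f u ≤ c * ‖restr T u‖ + c * ((∑ i ∈ T, |u i|) / √(s : ℝ)
          + l1Norm (restr Tᶜ u) / √(s : ℝ)) := by
        have := mul_le_mul_of_nonneg_left (add_le_add_left h3 (l1Norm (restr Tᶜ u) / √(s : ℝ))) hc
        linarith
      rw [hl1, add_div, mul_add]
      exact h4

/-- An integer vector as a Euclidean vector. -/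
noncomputable def intVec (k : Fin p → ℤ) : EuclideanSpace ℝ (Fin p) :=
  WithLp.toLp 2 fun i => (k i : ℝ)

lemma intVec_add (k k' : Fin p → ℤ) : intVec (k + k') = intVec k + intVec k' := by
  ext i; simp [intVec]

lemma intVec_sub (k k' : Fin p → ℤ) : intVec (k - k') = intVec k - intVec k' := by
  ext i; simp [intVec]

/-- Rounding towards zero. -/
lemma exists_int_abs_le (x : ℝ) : ∃ k : ℤ, |(k : ℝ)| ≤ |x| ∧ |x - k| ≤ 1 := by
  rcases le_total 0 x with h | h
  · have h0 : (0 : ℝ) ≤ ⌊x⌋ := by exact_mod_cast Int.floor_nonneg.2 h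
    refine ⟨⌊x⌋, ?_, ?_⟩
    · rw [abs_of_nonneg h0, abs_of_nonneg h]; exact Int.floor_le x
    · rw [abs_of_nonneg (sub_nonneg.2 (Int.floor_le x))]
      linarith [Int.lt_floor_add_one x]
  · have h0 : (⌈x⌉ : ℝ) ≤ 0 := by exact_mod_cast Int.ceil_le.2 (by simpa using h)
    refine ⟨⌈x⌉, ?_, ?_⟩
    · rw [abs_of_nonpos h0, abs_of_nonpos h]; linarith [Int.le_ceil x]
    · rw [abs_of_nonpos (sub_nonpos.2 (Int.le_ceil x))]
      linarith [Int.ceil_lt_add_one x]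

/-- Sparse vectors of the unit ball are within `1/4` of the lattice `ℤᵖ / (4 √s)`, and the nearby
lattice point corresponds to an integer vector of `ℓ₁` norm at most `4 s`. -/
lemma exists_intVec_near {s : ℕ} (hs : 1 ≤ s) {u : EuclideanSpace ℝ (Fin p)} (hu : IsSparse s u)
    (hu1 : ‖u‖ ≤ 1) :
    ∃ k : Fin p → ℤ, ∑ i, |k i| ≤ 4 * s ∧ ‖(4 * √(s : ℝ))⁻¹ • intVec k‖ ≤ 1 ∧
      (∀ i, u i = 0 → (k i : ℝ) = 0) ∧
      ‖u - (4 * √(s : ℝ))⁻¹ • intVec k‖ ≤ 1 / 4 := by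
  have hs0 : (0 : ℝ) < s := by exact_mod_cast hs
  have hs' : 0 < √(s : ℝ) := Real.sqrt_pos.2 hs0
  choose k hk1 hk2 using fun i => exists_int_abs_le (4 * √(s : ℝ) * u i)
  have hzero : ∀ i, u i = 0 → (k i : ℝ) = 0 := by
    intro i hi
    have := hk1 i
    rw [hi, mul_zero, abs_zero] at this
    exact abs_nonpos_iff.1 this
  have habs : ∀ i, |(k i : ℝ)| ≤ 4 * √(s : ℝ) * |u i| := fun i => by
    refine (hk1 i).trans_eq ?_
    rw [abs_mul, abs_of_pos (by positivity)]
  have hcard := hu.card_le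
  have hd : ∀ i, (u - (4 * √(s : ℝ))⁻¹ • intVec k) i =
      (4 * √(s : ℝ))⁻¹ * (4 * √(s : ℝ) * u i - k i) := by
    intro i
    simp only [PiLp.sub_apply, PiLp.smul_apply, intVec, smul_eq_mul]
    field_simp
  refine ⟨k, ?_, ?_, hzero, ?_⟩
  · have h1 : ∑ i, |(k i : ℝ)| ≤ 4 * s := by
      calc ∑ i, |(k i : ℝ)| = ∑ i with u i ≠ 0, |(k i : ℝ)| := by
            refine (Finset.sum_filter_of_ne fun i _ => ?_).symm
            refine mt fun hi => ?_
            rw [hzero i hi, abs_zero]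
        _ ≤ ∑ i with u i ≠ 0, 4 * √(s : ℝ) * |u i| := Finset.sum_le_sum fun i _ => habs i
        _ = 4 * √(s : ℝ) * ∑ i with u i ≠ 0, |u i| := by rw [Finset.mul_sum]
        _ ≤ 4 * √(s : ℝ) * (√(s : ℝ) * 1) := by
            have := sum_supp_abs_le hu u
            gcongr
            exact this.trans (by gcongr)
        _ = 4 * s := by rw [mul_one, mul_assoc, Real.mul_self_sqrt hs0.le]
    exact_mod_cast h1
  · refine le_trans ((sq_le_sq₀ (norm_nonneg _) (norm_nonneg u)).1 ?_) hu1
    rw [EuclideanSpace.real_norm_sq_eq, EuclideanSpace.real_norm_sq_eq]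
    refine Finset.sum_le_sum fun i _ => sq_le_sq.2 ?_
    simp only [PiLp.smul_apply, intVec, smul_eq_mul]
    rw [abs_mul, abs_of_pos (by positivity), inv_mul_le_iff₀ (by positivity)]
    exact habs i
  · refine (sq_le_sq₀ (norm_nonneg _) (by norm_num)).1 ?_
    rw [EuclideanSpace.real_norm_sq_eq]
    calc _ = ∑ i with u i ≠ 0, ((u - (4 * √(s : ℝ))⁻¹ • intVec k) i) ^ 2 := by
            refine (Finset.sum_filter_of_ne fun i _ => ?_).symm
            refine mt fun hi => ?_
            rw [hd, hi, hzero i hi]; simp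
      _ ≤ ∑ i with u i ≠ 0, ((4 * √(s : ℝ))⁻¹) ^ 2 := by
            refine Finset.sum_le_sum fun i _ => ?_
            rw [hd, mul_pow]
            refine mul_le_of_le_one_right (sq_nonneg _) ?_
            rw [← sq_abs]
            exact pow_le_one₀ (abs_nonneg _) (hk2 i)
      _ ≤ s * ((4 * √(s : ℝ))⁻¹) ^ 2 := by
            rw [Finset.sum_const, nsmul_eq_mul]
            gcongr
      _ = (1 / 4) ^ 2 := by
            rw [inv_pow, mul_pow, Real.sq_sqrt hs0.le]
            field_simp

/-- A symmetric bilinear form whose quadratic form is small on integer vectors of `ℓ₁` norm at most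
`8 s` is small for the mixed norm. The factor `8` rather than `4` leaves room for polarization. -/
lemma abs_le_mixN_of_intVec {s : ℕ} (hs : 1 ≤ s) (hsp : s ≤ p) {ε : ℝ} (hε : 0 ≤ ε)
    {B : EuclideanSpace ℝ (Fin p) →ₗ[ℝ] EuclideanSpace ℝ (Fin p) →ₗ[ℝ] ℝ}
    (hsymm : ∀ u v, B u v = B v u)
    (hB : ∀ k : Fin p → ℤ, ∑ i, |k i| ≤ 8 * s →
      |B (intVec k) (intVec k)| ≤ ε * ‖intVec k‖ ^ 2) (u v : EuclideanSpace ℝ (Fin p)) :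
    |B u v| ≤ 2 * ε * (mixN s u * mixN s v) := by
  have hs0 : (0 : ℝ) < s := by exact_mod_cast hs
  have hs' : 0 < √(s : ℝ) := Real.sqrt_pos.2 hs0
  have hpair : ∀ k k' : Fin p → ℤ, ∑ i, |k i| ≤ 4 * s → ∑ i, |k' i| ≤ 4 * s →
      |B (intVec k) (intVec k')| ≤ ε * ((‖intVec k‖ ^ 2 + ‖intVec k'‖ ^ 2) / 2) := by
    intro k k' hk hk'
    have h1 := hB (k + k') (by
      calc ∑ i, |(k + k') i| ≤ ∑ i, (|k i| + |k' i|) :=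
            Finset.sum_le_sum fun i _ => abs_add_le _ _
        _ ≤ 8 * s := by rw [Finset.sum_add_distrib]; linarith)
    have h2 := hB (k - k') (by
      calc ∑ i, |(k - k') i| ≤ ∑ i, (|k i| + |k' i|) :=
            Finset.sum_le_sum fun i _ => abs_sub _ _
        _ ≤ 8 * s := by rw [Finset.sum_add_distrib]; linarith)
    rw [intVec_add] at h1
    rw [intVec_sub] at h2
    have hpol : 4 * B (intVec k) (intVec k') =
        B (intVec k + intVec k') (intVec k + intVec k')
          - B (intVec k - intVec k') (intVec k - intVec k') := by
      simp only [map_add, map_sub, LinearMap.add_apply, LinearMap.sub_apply]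
      rw [hsymm (intVec k') (intVec k)]; ring
    have hpar := parallelogram_law_with_norm ℝ (intVec k) (intVec k')
    have h3 : |4 * B (intVec k) (intVec k')| ≤
        ε * (‖intVec k + intVec k'‖ ^ 2 + ‖intVec k - intVec k'‖ ^ 2) := by
      rw [hpol, mul_add]
      exact (abs_sub _ _).trans (add_le_add h1 h2)
    rw [abs_mul, abs_of_pos (by norm_num : (0 : ℝ) < 4)] at h3
    have h4 : ‖intVec k + intVec k'‖ ^ 2 + ‖intVec k - intVec k'‖ ^ 2 =
        2 * (‖intVec k‖ ^ 2 + ‖intVec k'‖ ^ 2) := by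
      exact hpar
    rw [h4] at h3
    linarith
  have hlattice : ∀ k k' : Fin p → ℤ, ∑ i, |k i| ≤ 4 * s → ∑ i, |k' i| ≤ 4 * s →
      ‖(4 * √(s : ℝ))⁻¹ • intVec k‖ ≤ 1 → ‖(4 * √(s : ℝ))⁻¹ • intVec k'‖ ≤ 1 →
      |B ((4 * √(s : ℝ))⁻¹ • intVec k) ((4 * √(s : ℝ))⁻¹ • intVec k')| ≤ ε := by
    intro k k' hk hk' h1 h2
    have h := hpair k k' hk hk'
    set c := (4 * √(s : ℝ))⁻¹ with hc
    have hc0 : 0 < c := by positivity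
    rw [norm_smul, Real.norm_of_nonneg hc0.le] at h1 h2
    rw [map_smul, map_smul, LinearMap.smul_apply, smul_eq_mul, smul_eq_mul, abs_mul, abs_mul,
      abs_of_pos hc0]
    have h1' : c ^ 2 * ‖intVec k‖ ^ 2 ≤ 1 := by
      rw [← mul_pow]; exact pow_le_one₀ (by positivity) h1
    have h2' : c ^ 2 * ‖intVec k'‖ ^ 2 ≤ 1 := by
      rw [← mul_pow]; exact pow_le_one₀ (by positivity) h2
    calc c * (c * |B (intVec k) (intVec k')|) ≤
          c * (c * (ε * ((‖intVec k‖ ^ 2 + ‖intVec k'‖ ^ 2) / 2))) := by gcongr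
      _ = ε * ((c ^ 2 * ‖intVec k‖ ^ 2 + c ^ 2 * ‖intVec k'‖ ^ 2) / 2) := by ring
      _ ≤ ε * ((1 + 1) / 2) := by gcongr
      _ = ε := by ring
  -- Any bound `c` over the sparse vectors of the unit ball improves to `ε + c / 2` by passing to
  -- nearby lattice points; iterating, it improves to `2 ε`.
  have hhalf : ∀ c : ℝ, (∀ x y, IsSparse s x → IsSparse s y → |B x y| ≤ c * (‖x‖ * ‖y‖)) → 0 ≤ c →
      ∀ x y, IsSparse s x → IsSparse s y → ‖x‖ ≤ 1 → ‖y‖ ≤ 1 → |B x y| ≤ ε + c / 2 := by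
    intro c hc hc0 x y hx hy hx1 hy1
    obtain ⟨k, hk, hk1, hks, hkd⟩ := exists_intVec_near hs hx hx1
    obtain ⟨k', hk', hk1', hks', hkd'⟩ := exists_intVec_near hs hy hy1
    have h0 := hlattice k k' hk hk' hk1 hk1'
    set x₀ := (4 * √(s : ℝ))⁻¹ • intVec k
    set y₀ := (4 * √(s : ℝ))⁻¹ • intVec k'
    have hx₀ : IsSparse s x₀ := hx.mono fun i hi => by simp [x₀, intVec, hks i hi]
    have hxx₀ : IsSparse s (x - x₀) := hx.mono fun i hi => by simp [x₀, intVec, hks i hi, hi]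
    have hyy₀ : IsSparse s (y - y₀) := hy.mono fun i hi => by simp [y₀, intVec, hks' i hi, hi]
    have e1 := hc (x - x₀) y hxx₀ hy
    have e2 := hc x₀ (y - y₀) hx₀ hyy₀
    have e : B x y = B x₀ y₀ + B (x - x₀) y + B x₀ (y - y₀) := by
      simp only [map_sub, LinearMap.sub_apply]; ring
    have e1' : |B (x - x₀) y| ≤ c * (1 / 4 * 1) :=
      e1.trans (by gcongr)
    have e2' : |B x₀ (y - y₀)| ≤ c * (1 * (1 / 4)) :=
      e2.trans (by gcongr)
    rw [e]
    refine (abs_add_three _ _ _).trans ?_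
    linarith
  have hhom : ∀ d : ℝ, 0 ≤ d →
      (∀ x y, IsSparse s x → IsSparse s y → ‖x‖ ≤ 1 → ‖y‖ ≤ 1 → |B x y| ≤ d) →
      ∀ x y, IsSparse s x → IsSparse s y → |B x y| ≤ d * (‖x‖ * ‖y‖) := by
    intro d _ hd x y hx hy
    rcases eq_or_ne x 0 with rfl | hx0
    · simp
    rcases eq_or_ne y 0 with rfl | hy0
    · simp
    have hx1 := norm_pos_iff.2 hx0
    have hy1 := norm_pos_iff.2 hy0
    have h := hd (‖x‖⁻¹ • x) (‖y‖⁻¹ • y) (hx.mono fun i hi => by simp [hi])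
      (hy.mono fun i hi => by simp [hi])
      (by rw [norm_smul, norm_inv, norm_norm, inv_mul_cancel₀ hx1.ne'])
      (by rw [norm_smul, norm_inv, norm_norm, inv_mul_cancel₀ hy1.ne'])
    rw [map_smul, map_smul, LinearMap.smul_apply, smul_eq_mul, smul_eq_mul, abs_mul, abs_mul,
      abs_of_pos (inv_pos.2 hx1), abs_of_pos (inv_pos.2 hy1), inv_mul_le_iff₀ hy1,
      inv_mul_le_iff₀ hx1] at h
    linarith
  obtain ⟨C, hC0, hC⟩ : ∃ C : ℝ, 0 ≤ C ∧ ∀ x y, |B x y| ≤ C * (‖x‖ * ‖y‖) :=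
    ⟨‖B.toContinuousBilinearMap‖, ContinuousLinearMap.opNorm_nonneg _, fun x y => by
      rw [← mul_assoc]
      exact B.toContinuousBilinearMap.le_opNorm₂ x y⟩
  have hiter : ∀ n : ℕ, ∀ x y, IsSparse s x → IsSparse s y →
      |B x y| ≤ (2 * ε + C * (1 / 2) ^ n) * (‖x‖ * ‖y‖) := by
    intro n
    induction n with
    | zero =>
      intro x y _ _
      refine (hC x y).trans (mul_le_mul_of_nonneg_right ?_ (by positivity))
      linarith
    | succ n ih =>
      refine hhom _ (by positivity) fun x y hx hy hx1 hy1 => ?_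
      refine (hhalf _ ih (by positivity) x y hx hy hx1 hy1).trans_eq ?_
      rw [pow_succ]; ring
  have hsparse : ∀ x y, IsSparse s x → IsSparse s y → |B x y| ≤ 2 * ε * (‖x‖ * ‖y‖) := by
    intro x y hx hy
    have hlim : Filter.Tendsto (fun n : ℕ => (2 * ε + C * (1 / 2) ^ n) * (‖x‖ * ‖y‖))
        Filter.atTop (nhds ((2 * ε + C * 0) * (‖x‖ * ‖y‖))) :=
      ((tendsto_const_nhds.add (tendsto_const_nhds.mul
        (tendsto_pow_atTop_nhds_zero_of_lt_one (by norm_num) (by norm_num)))).mul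
          tendsto_const_nhds)
    rw [mul_zero, add_zero] at hlim
    exact ge_of_tendsto' hlim fun n => hiter n x y hx hy
  have hleft : ∀ y, IsSparse s y → |B u y| ≤ 2 * ε * mixN s u * ‖y‖ := by
    intro y hy
    have := le_mul_mixN_of_sparse hs hsp (c := 2 * ε * ‖y‖) (by positivity)
      (f := fun x => |B x y|) (fun a b => by
        simp only [map_add, LinearMap.add_apply]; exact abs_add_le _ _)
      (fun z hz => (hsparse z y hz hy).trans_eq (by ring)) u
    refine this.trans_eq (by ring)
  have hmix := mixN_nonneg s u
  refine (le_mul_mixN_of_sparse hs hsp (c := 2 * ε * mixN s u) (by positivity)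
      (f := fun y => |B u y|) (fun a b => by
        simp only [map_add]; exact abs_add_le _ _) hleft v).trans_eq (by ring)

/-! ### Counting integer vectors in an `ℓ₁` ball -/

lemma sum_Icc_pow_natAbs_le {x : ℝ} (hx0 : 0 ≤ x) (hx : x ≤ 1 / 2) (m : ℕ) :
    ∑ j ∈ Finset.Icc (-(m : ℤ)) m, x ^ j.natAbs ≤ 1 + 4 * x - 4 * x ^ (m + 1) := by
  induction m with
  | zero => simp
  | succ m ih =>
    have h : Finset.Icc (-((m + 1 : ℕ) : ℤ)) ((m + 1 : ℕ) : ℤ) =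
        insert (((m + 1 : ℕ) : ℤ)) (insert (-((m + 1 : ℕ) : ℤ)) (Finset.Icc (-(m : ℤ)) m)) := by
      ext j; simp only [Finset.mem_Icc, Finset.mem_insert]; omega
    rw [h, Finset.sum_insert, Finset.sum_insert, Int.natAbs_neg, Int.natAbs_natCast]
    · have h1 : x ^ (m + 1 + 1) ≤ x ^ (m + 1) * (1 / 2) := by
        rw [pow_succ]; gcongr
      linarith
    · simp only [Finset.mem_Icc]; omega
    · simp only [Finset.mem_insert, Finset.mem_Icc]; omega

/-- The integer vectors of `ℓ₁` norm at most `8 s`. -/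
noncomputable def intBall (p s : ℕ) : Finset (Fin p → ℤ) :=
  (Fintype.piFinset fun _ => Finset.Icc (-((8 * s : ℕ) : ℤ)) ((8 * s : ℕ) : ℤ)).filter
    fun k => ∑ i, |k i| ≤ 8 * s

lemma mem_intBall {p s : ℕ} {k : Fin p → ℤ} (hk : ∑ i, |k i| ≤ 8 * s) : k ∈ intBall p s := by
  refine Finset.mem_filter.2 ⟨Fintype.mem_piFinset.2 fun i => ?_, hk⟩
  have h : |k i| ≤ 8 * s :=
    (Finset.single_le_sum (fun _ _ => abs_nonneg _) (Finset.mem_univ i)).trans hk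
  have := abs_le.1 h
  rw [Finset.mem_Icc]
  push_cast
  exact this

/-- The cardinality bound comes from the generating function `∑ₖ x^{‖k‖₁}` at `x = s / (2 p)`. -/
lemma card_intBall_le {p s : ℕ} (hs : 1 ≤ s) (hsp : s ≤ p) :
    ((intBall p s).card : ℝ) ≤ Real.exp (10 * (s * Real.log (Real.exp 1 * p / s))) := by
  have hs0 : (0 : ℝ) < s := by exact_mod_cast hs
  have hp0 : (0 : ℝ) < p := hs0.trans_le (by exact_mod_cast hsp)
  have hsp' : (s : ℝ) ≤ p := by exact_mod_cast hsp
  set x : ℝ := s / (2 * p) with hx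
  have hx0 : 0 < x := by positivity
  have hx2 : x ≤ 1 / 2 := by
    rw [hx, div_le_div_iff₀ (by positivity) (by norm_num)]; linarith
  have h1 : ((intBall p s).card : ℝ) * x ^ (8 * s) ≤ (1 + 4 * x) ^ p := by
    calc ((intBall p s).card : ℝ) * x ^ (8 * s) = ∑ _k ∈ intBall p s, x ^ (8 * s) := by
          rw [Finset.sum_const, nsmul_eq_mul]
      _ ≤ ∑ k ∈ intBall p s, ∏ i, x ^ (k i).natAbs := by
          refine Finset.sum_le_sum fun k hk => ?_
          rw [Finset.prod_pow_eq_pow_sum]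
          refine pow_le_pow_of_le_one hx0.le (by linarith) ?_
          have := (Finset.mem_filter.1 hk).2
          zify
          exact this
      _ ≤ ∑ k ∈ Fintype.piFinset fun _ => Finset.Icc (-((8 * s : ℕ) : ℤ)) ((8 * s : ℕ) : ℤ),
            ∏ i : Fin p, x ^ (k i).natAbs :=
          Finset.sum_le_sum_of_subset_of_nonneg (Finset.filter_subset _ _)
            fun _ _ _ => by positivity
      _ = ∏ _i : Fin p, ∑ j ∈ Finset.Icc (-((8 * s : ℕ) : ℤ)) ((8 * s : ℕ) : ℤ),
            x ^ j.natAbs :=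
          (Finset.prod_univ_sum (fun _ => Finset.Icc (-((8 * s : ℕ) : ℤ)) ((8 * s : ℕ) : ℤ))
            fun _ j => x ^ j.natAbs).symm
      _ ≤ (1 + 4 * x) ^ p := by
          rw [Finset.prod_const, Finset.card_univ, Fintype.card_fin]
          refine pow_le_pow_left₀ (Finset.sum_nonneg fun _ _ => by positivity) ?_ p
          refine (sum_Icc_pow_natAbs_le hx0.le hx2 (8 * s)).trans ?_
          have : 0 ≤ x ^ (8 * s + 1) := by positivity
          linarith
  have h2 : (1 + 4 * x) ^ p ≤ Real.exp (2 * s) := by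
    calc (1 + 4 * x) ^ p ≤ Real.exp (4 * x) ^ p := by
          refine pow_le_pow_left₀ (by positivity) ?_ p
          have := Real.add_one_le_exp (4 * x)
          linarith
      _ = Real.exp (2 * s) := by
          rw [← Real.exp_nat_mul, hx]
          congr 1
          field_simp
          norm_num
  have hlog : Real.log (Real.exp 1 * p / s) = 1 + Real.log (p / s) := by
    rw [mul_div_assoc, Real.log_mul (Real.exp_pos 1).ne' (by positivity), Real.log_exp]
  have hlogx : -Real.log x ≤ 1 + Real.log (p / s) := by
    have h : x = (2 * ((p : ℝ) / s))⁻¹ := by rw [hx]; field_simp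
    rw [h, Real.log_inv, neg_neg, Real.log_mul (by norm_num) (by positivity)]
    have := Real.log_two_lt_d9
    linarith
  have hlog0 : 0 ≤ Real.log (p / s) := Real.log_nonneg ((one_le_div hs0).2 hsp')
  have h3 : x ^ (8 * s) = Real.exp (8 * s * Real.log x) := by
    rw [← Real.exp_log hx0, ← Real.exp_nat_mul, Real.log_exp]
    push_cast
    rfl
  rw [h3] at h1
  calc ((intBall p s).card : ℝ) ≤ Real.exp (2 * s) / Real.exp (8 * s * Real.log x) := by
        rw [le_div_iff₀ (Real.exp_pos _)]; exact h1.trans h2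
    _ = Real.exp (2 * s - 8 * s * Real.log x) := (Real.exp_sub _ _).symm
    _ ≤ _ := by
        rw [Real.exp_le_exp, hlog]
        nlinarith [mul_nonneg hs0.le hlog0, mul_le_mul_of_nonneg_left hlogx hs0.le]

/-! ### Tails of the empirical variance of standard Gaussian variables -/

section Scalar

open MeasureTheory ProbabilityTheory Real

lemma integral_exp_mul_sq_gaussianReal {y : ℝ} (hy : y < 1 / 2) :
    ∫ x, exp (y * x ^ 2) ∂(gaussianReal 0 1) = (√(1 - 2 * y))⁻¹ := by
  rw [integral_gaussianReal_eq_integral_smul one_ne_zero]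
  have h : ∀ x : ℝ, gaussianPDFReal 0 1 x • exp (y * x ^ 2) =
      (√(2 * π))⁻¹ * exp (-(1 / 2 - y) * x ^ 2) := by
    intro x
    rw [gaussianPDFReal_def, smul_eq_mul, NNReal.coe_one, mul_one, mul_assoc, ← exp_add]
    congr 2
    ring
  simp_rw [h]
  rw [integral_const_mul, integral_gaussian, ← Real.sqrt_inv, ← Real.sqrt_inv,
    ← Real.sqrt_mul (by positivity)]
  congr 1
  have : 1 / 2 - y ≠ 0 := by linarith
  have h2 : 1 - 2 * y ≠ 0 := by linarith
  have := pi_ne_zero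
  field_simp

/-- `e^{2y - 2y²} ≤ 1 + 2y`. -/
lemma exp_le_one_add {y : ℝ} (hy : 0 ≤ y) : exp (2 * y - 2 * y ^ 2) ≤ 1 + 2 * y := by
  rw [← le_log_iff_exp_le (by linarith)]
  refine le_trans ?_ (le_log_one_add_of_nonneg (by linarith))
  rw [le_div_iff₀ (by linarith)]
  nlinarith [pow_nonneg hy 3]

/-- `e^{-(2y + 4y²)} ≤ 1 - 2y`. -/
lemma exp_neg_le_one_sub {y : ℝ} (hy : 0 ≤ y) (hy' : y ≤ 1 / 4) :
    exp (-(2 * y + 4 * y ^ 2)) ≤ 1 - 2 * y := by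
  rw [exp_neg, inv_le_comm₀ (exp_pos _) (by linarith)]
  refine le_trans ?_ (quadratic_le_exp_of_nonneg (by positivity))
  rw [inv_le_iff_one_le_mul₀ (by linarith)]
  have h : (0 : ℝ) ≤ 2 * y ^ 2 * (1 - 2 * y - 4 * y ^ 2 - 8 * y ^ 3) := by
    have h3 : y ^ 2 ≤ 1 / 16 := by nlinarith
    have h4 : y ^ 3 ≤ 1 / 64 := by nlinarith
    have : 0 ≤ 1 - 2 * y - 4 * y ^ 2 - 8 * y ^ 3 := by linarith
    positivity
  nlinarith [h]

/-- `1 - 2y ≤ e^{-(2y + 2y²)}`. -/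
lemma one_sub_le_exp_neg {y : ℝ} (hy : 0 ≤ y) (hy' : y < 1 / 2) :
    1 - 2 * y ≤ exp (-(2 * y + 2 * y ^ 2)) := by
  have h1 : 0 < 1 - 2 * y := by linarith
  rw [exp_neg, le_inv_comm₀ h1 (exp_pos _), ← le_log_iff_exp_le (by positivity)]
  have h2 : (1 - 2 * y)⁻¹ = 1 + 2 * y / (1 - 2 * y) := by field_simp; ring
  rw [h2]
  refine le_trans ?_ (le_log_one_add_of_nonneg (by positivity))
  have h3 : 2 * (2 * y / (1 - 2 * y)) / (2 * y / (1 - 2 * y) + 2) = 2 * y / (1 - y) := by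
    have : 1 - y ≠ 0 := by linarith
    have h4 : 2 * y + (1 - 2 * y) * 2 ≠ 0 := by linarith
    field_simp
    ring
  rw [h3, le_div_iff₀ (by linarith)]
  nlinarith [pow_nonneg hy 3]

variable {Ω : Type*} [MeasurableSpace Ω] {μ : Measure Ω} {n : ℕ}
  {g : Fin n → Ω → ℝ}

section

variable (hind : iIndepFun g μ) (hlaw : ∀ i, HasLaw (g i) (gaussianReal 0 1) μ)

include hind hlaw

lemma mgf_sum_sq {y : ℝ} (hy : y < 1 / 2) :
    mgf (fun ω => ∑ i, g i ω ^ 2) μ y = (√(1 - 2 * y))⁻¹ ^ n := by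
  have hind2 : iIndepFun (fun i ω => g i ω ^ 2) μ :=
    hind.comp (fun _ x => x ^ 2) fun _ => by fun_prop
  have h := hind2.mgf_sum₀ (t := y) (fun i => (hlaw i).aemeasurable.pow_const 2) Finset.univ
  have h1 : ∀ i, mgf (fun ω => g i ω ^ 2) μ y = (√(1 - 2 * y))⁻¹ := by
    intro i
    rw [← integral_exp_mul_sq_gaussianReal hy]
    exact (hlaw i).integral_comp (f := fun x => exp (y * x ^ 2)) (by fun_prop)
  simp only [h1, Finset.prod_const, Finset.card_univ, Fintype.card_fin] at h
  rw [← h]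
  congr 1
  ext ω
  simp

lemma integrable_exp_sum_sq {y : ℝ} (hy : y < 1 / 2) :
    Integrable (fun ω => exp (y * ∑ i, g i ω ^ 2)) μ := by
  by_contra hni
  have h := mgf_sum_sq hind hlaw hy
  rw [mgf, integral_undef hni] at h
  have : 0 < (√(1 - 2 * y))⁻¹ ^ n := by
    have : 0 < 1 - 2 * y := by linarith
    positivity
  linarith

lemma mgf_sum_sq_le {y c : ℝ} (hy : y < 1 / 2) (hc : exp (-(2 * c)) ≤ 1 - 2 * y) :
    mgf (fun ω => ∑ i, g i ω ^ 2) μ y ≤ exp (n * c) := by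
  rw [mgf_sum_sq hind hlaw hy, exp_nat_mul]
  refine pow_le_pow_left₀ (by positivity) ?_ n
  have h1 : exp (-c) ≤ √(1 - 2 * y) := by
    refine le_sqrt_of_sq_le ?_
    rw [← exp_nat_mul]
    refine le_trans (le_of_eq ?_) hc
    congr 1; push_cast; ring
  rw [inv_le_comm₀ (lt_of_lt_of_le (exp_pos _) h1) (exp_pos _), ← exp_neg]
  exact h1

lemma le_mgf_sum_sq {y c : ℝ} (hy : y < 1 / 2) (hc : 1 - 2 * y ≤ exp (-(2 * c))) :
    exp (n * c) ≤ mgf (fun ω => ∑ i, g i ω ^ 2) μ y := by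
  rw [mgf_sum_sq hind hlaw hy, exp_nat_mul]
  refine pow_le_pow_left₀ (by positivity) ?_ n
  have h0 : 0 < √(1 - 2 * y) := sqrt_pos.2 (by linarith)
  have h1 : √(1 - 2 * y) ≤ exp (-c) := by
    refine sqrt_le_iff.2 ⟨(exp_pos _).le, hc.trans (le_of_eq ?_)⟩
    rw [← exp_nat_mul]
    congr 1; push_cast; ring
  rw [le_inv_comm₀ (exp_pos _) h0, ← exp_neg]
  exact h1

variable [IsProbabilityMeasure μ]

lemma sum_sq_upper_tail {ε : ℝ} (hε : 0 ≤ ε) (hε' : ε ≤ 1) :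
    μ.real {ω | n * (1 + ε) ≤ ∑ i, g i ω ^ 2} ≤ exp (-(n * ε ^ 2 / 8)) := by
  have hy : ε / 4 < 1 / 2 := by linarith
  refine (measure_ge_le_exp_mul_mgf _ (by positivity : 0 ≤ ε / 4)
    (integrable_exp_sum_sq hind hlaw hy)).trans ?_
  have h := mgf_sum_sq_le hind hlaw (c := ε / 4 + 2 * (ε / 4) ^ 2) hy
    (le_trans (le_of_eq (by ring_nf))
      (exp_neg_le_one_sub (by positivity : 0 ≤ ε / 4) (by linarith)))
  refine (mul_le_mul_of_nonneg_left h (exp_pos _).le).trans_eq ?_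
  rw [← exp_add]
  congr 1
  ring

lemma sum_sq_lower_tail {ε : ℝ} (hε : 0 ≤ ε) :
    μ.real {ω | ∑ i, g i ω ^ 2 ≤ n * (1 - ε)} ≤ exp (-(n * ε ^ 2 / 4)) := by
  have hy : -(ε / 2) < 1 / 2 := by linarith
  refine (measure_le_le_exp_mul_mgf _ (by linarith : -(ε / 2) ≤ 0)
    (integrable_exp_sum_sq hind hlaw hy)).trans ?_
  have h := mgf_sum_sq_le hind hlaw (c := -(ε / 2) + (ε / 2) ^ 2) hy
    (le_trans (le_of_eq (by ring_nf))
      ((exp_le_one_add (by positivity : 0 ≤ ε / 2)).trans_eq (by ring)))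
  refine (mul_le_mul_of_nonneg_left h (exp_pos _).le).trans_eq ?_
  rw [← exp_add]
  congr 1
  ring

lemma sq_sum_tail (hn : 1 ≤ n) {a : ℝ} (ha : 0 ≤ a) :
    μ.real {ω | n * a ≤ (∑ i, g i ω) ^ 2} ≤ 2 * exp (-(a / 2)) := by
  have hn0 : (0 : ℝ) < n := by exact_mod_cast hn
  have hsub : ∀ i ∈ (Finset.univ : Finset (Fin n)), HasSubgaussianMGF (g i) 1 μ := by
    intro i _
    have hmgf : ∀ t, mgf (g i) μ t = exp (t ^ 2 / 2) := fun t => by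
      rw [mgf_gaussianReal (hlaw i).map_eq]; simp
    refine ⟨fun t => ?_, fun t => by rw [hmgf]; simp⟩
    -- The integral is nonzero, hence not the junk value of a nonintegrable function.
    by_contra hni
    have h := hmgf t
    rw [mgf, integral_undef hni] at h
    exact (exp_pos _).ne h
  have hsum := HasSubgaussianMGF.sum_of_iIndepFun hind hsub
  have hna : 0 ≤ √(n * a) := sqrt_nonneg _
  have e : exp (-√(n * a) ^ 2 / (2 * ((∑ _i : Fin n, (1 : NNReal) : NNReal) : ℝ))) =
      exp (-(a / 2)) := by
    rw [sq_sqrt (by positivity)]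
    congr 1
    simp only [Finset.sum_const, Finset.card_univ, Fintype.card_fin, nsmul_eq_mul, mul_one,
      NNReal.coe_natCast]
    field_simp
  have h1 := hsum.measure_ge_le hna
  have h2 := hsum.neg.measure_ge_le hna
  rw [e] at h1 h2
  have hsubset : {ω | n * a ≤ (∑ i, g i ω) ^ 2} ⊆
      {ω | √(n * a) ≤ ∑ i, g i ω} ∪ {ω | √(n * a) ≤ (-fun ω => ∑ i, g i ω) ω} := by
    intro ω hω
    have h3 : √(n * a) ≤ |∑ i, g i ω| := by
      rw [← sqrt_sq_eq_abs]; exact sqrt_le_sqrt hω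
    rcases le_abs.1 h3 with h | h
    · exact Or.inl h
    · exact Or.inr h
  calc _ ≤ _ := measureReal_mono hsubset
    _ ≤ _ := measureReal_union_le _ _
    _ ≤ 2 * exp (-(a / 2)) := by linarith

/-- The empirical variance is within `ε` of `1` up to an exponentially small probability. -/
lemma emp_var_two_sided (hn : 1 ≤ n) {ε : ℝ} (hε : 0 ≤ ε) (hε' : ε ≤ 1) :
    μ.real {ω | ε < |(∑ i, g i ω ^ 2) / n - ((∑ i, g i ω) / n) ^ 2 - 1|} ≤
      4 * exp (-(n * ε ^ 2 / 16)) := by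
  have hn0 : (0 : ℝ) < n := by exact_mod_cast hn
  have hsubset : {ω | ε < |(∑ i, g i ω ^ 2) / n - ((∑ i, g i ω) / n) ^ 2 - 1|} ⊆
      {ω | n * (1 + ε) ≤ ∑ i, g i ω ^ 2} ∪ ({ω | ∑ i, g i ω ^ 2 ≤ n * (1 - ε / 2)} ∪
        {ω | n * (n * (ε / 2)) ≤ (∑ i, g i ω) ^ 2}) := by
    intro ω hω
    by_contra hcon
    simp only [Set.mem_union, Set.mem_ofPred_eq, not_or, not_le] at hcon
    obtain ⟨h1, h2, h3⟩ := hcon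
    refine (not_lt.2 ?_) (show ε < _ from hω)
    have e1 : (∑ i, g i ω ^ 2) / n ≤ 1 + ε := (div_le_iff₀' hn0).2 h1.le
    have e2 : 1 - ε / 2 ≤ (∑ i, g i ω ^ 2) / n := (le_div_iff₀' hn0).2 h2.le
    have e3 : ((∑ i, g i ω) / n) ^ 2 ≤ ε / 2 := by
      rw [div_pow, div_le_iff₀ (by positivity)]
      nlinarith
    have e4 := sq_nonneg ((∑ i, g i ω) / n)
    rw [abs_le]
    constructor <;> linarith
  have h1 := sum_sq_upper_tail hind hlaw hε hε'
  have h2 := sum_sq_lower_tail hind hlaw (ε := ε / 2) (by positivity)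
  have h3 := sq_sum_tail hind hlaw hn (a := n * (ε / 2)) (by positivity)
  have hε2 : ε ^ 2 ≤ ε := by nlinarith
  have b1 : exp (-(n * ε ^ 2 / 8)) ≤ exp (-(n * ε ^ 2 / 16)) := by
    rw [exp_le_exp]; nlinarith [mul_nonneg hn0.le (sq_nonneg ε)]
  have b2 : exp (-(n * (ε / 2) ^ 2 / 4)) = exp (-(n * ε ^ 2 / 16)) := by
    congr 1; ring
  have b3 : exp (-(n * (ε / 2) / 2)) ≤ exp (-(n * ε ^ 2 / 16)) := by
    rw [exp_le_exp]
    have := mul_le_mul_of_nonneg_left hε2 hn0.le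
    nlinarith [mul_nonneg hn0.le hε]
  calc _ ≤ _ := measureReal_mono hsubset
    _ ≤ _ := (measureReal_union_le _ _).trans (add_le_add_right (measureReal_union_le _ _) _)
    _ ≤ _ := by linarith

/-- Paley–Zygmund for `exp (y ∑ gᵢ²)` with `y = 1 / (2 √n)`: the sum of squares exceeds its mean by
the order of its standard deviation with probability bounded below. -/
lemma sum_sq_anticoncentration (hn : 64 ≤ n) :
    1 / 512 ≤ μ.real {ω | n + √n / 4 < ∑ i, g i ω ^ 2} := by
  have hn0 : (64 : ℝ) ≤ n := by exact_mod_cast hn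
  have hsq : (8 : ℝ) ≤ √n := by
    rw [show (8 : ℝ) = √64 by rw [show (64 : ℝ) = 8 ^ 2 by norm_num, sqrt_sq (by norm_num)]]
    exact sqrt_le_sqrt hn0
  have hss : √(n : ℝ) * √n = n := mul_self_sqrt (by linarith)
  set y : ℝ := 1 / (2 * √n) with hy
  have hy0 : 0 < y := by positivity
  have hy1 : y ≤ 1 / 16 := by
    rw [hy, div_le_div_iff₀ (by positivity) (by norm_num)]; linarith
  have hny2 : n * y ^ 2 = 1 / 4 := by
    rw [hy, div_pow, mul_pow, sq_sqrt (by linarith)]; field_simp; norm_num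
  have hysn : y * (√n / 4) = 1 / 8 := by rw [hy]; field_simp; norm_num
  set Q : Ω → ℝ := fun ω => ∑ i, g i ω ^ 2 with hQ
  set A : Set Ω := {ω | n + √n / 4 < Q ω} with hA
  have hQm : AEMeasurable Q μ :=
    Finset.aemeasurable_fun_sum _ fun i _ => (hlaw i).aemeasurable.pow_const 2
  have hAm : NullMeasurableSet A μ := nullMeasurableSet_lt aemeasurable_const hQm
  have hI1 : Integrable (fun ω => exp (y * Q ω)) μ :=
    integrable_exp_sum_sq hind hlaw (by linarith)
  have hI2 : Integrable (fun ω => exp (2 * y * Q ω)) μ :=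
    integrable_exp_sum_sq hind hlaw (by linarith)
  have hlow : exp (n * y + 1 / 4) ≤ ∫ ω, exp (y * Q ω) ∂μ := by
    have h := le_mgf_sum_sq hind hlaw (y := y) (c := y + y ^ 2) (by linarith)
      ((one_sub_le_exp_neg hy0.le (by linarith)).trans_eq (by ring_nf))
    refine le_trans (le_of_eq ?_) h
    rw [mul_add, hny2]
  have hupp : ∫ ω, exp (2 * y * Q ω) ∂μ ≤ exp (2 * (n * y) + 2) := by
    have h := mgf_sum_sq_le hind hlaw (y := 2 * y) (c := 2 * y + 8 * y ^ 2) (by linarith)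
      (le_trans (le_of_eq (by ring_nf))
        (exp_neg_le_one_sub (by linarith : 0 ≤ 2 * y) (by linarith)))
    refine h.trans_eq ?_
    congr 1
    linear_combination 8 * hny2
  set c : ℝ := exp (-(n * y)) / (8 * exp 2) with hc
  have hc0 : 0 < c := by positivity
  -- The weighted form `Z ≤ c Z² / 2 + 1 / (2 c)` of Cauchy–Schwarz, applied on `A` only.
  have hpt : ∀ ω, exp (y * Q ω) ≤ exp (n * y + 1 / 8) + c / 2 * exp (2 * y * Q ω)
      + 1 / (2 * c) * A.indicator (fun _ => (1 : ℝ)) ω := by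
    intro ω
    have h0 : 0 ≤ c / 2 * exp (2 * y * Q ω) := by positivity
    by_cases hω : ω ∈ A
    · rw [Set.indicator_of_mem hω, mul_one]
      have e2 : exp (2 * y * Q ω) = exp (y * Q ω) ^ 2 := by
        rw [← exp_nat_mul]; congr 1; push_cast; ring
      have hsq' := sq_nonneg (c * exp (y * Q ω) - 1)
      have h1 : exp (y * Q ω) ≤ c / 2 * exp (y * Q ω) ^ 2 + 1 / (2 * c) := by
        rw [← sub_nonneg]
        have : c / 2 * exp (y * Q ω) ^ 2 + 1 / (2 * c) - exp (y * Q ω) =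
            (c * exp (y * Q ω) - 1) ^ 2 / (2 * c) := by field_simp; ring
        rw [this]; positivity
      rw [e2]
      linarith [exp_pos (n * y + 1 / 8)]
    · rw [Set.indicator_of_notMem hω, mul_zero, add_zero]
      have h1 : exp (y * Q ω) ≤ exp (n * y + 1 / 8) := by
        rw [exp_le_exp]
        have h2 : Q ω ≤ n + √n / 4 := not_lt.1 hω
        have h3 := mul_le_mul_of_nonneg_left h2 hy0.le
        rw [mul_add, hysn] at h3
        linarith
      linarith
  have hind1 : Integrable (A.indicator fun _ => (1 : ℝ)) μ :=
    (integrable_const (1 : ℝ)).indicator₀ hAm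
  have hI12 : Integrable (fun ω => exp (n * y + 1 / 8) + c / 2 * exp (2 * y * Q ω)) μ :=
    (integrable_const _).add (hI2.const_mul _)
  have hint := integral_mono hI1 (hI12.add (hind1.const_mul (1 / (2 * c)))) hpt
  have hrhs : ∫ ω, (exp (n * y + 1 / 8) + c / 2 * exp (2 * y * Q ω)
      + 1 / (2 * c) * A.indicator (fun _ => (1 : ℝ)) ω) ∂μ =
      exp (n * y + 1 / 8) + c / 2 * ∫ ω, exp (2 * y * Q ω) ∂μ + 1 / (2 * c) * μ.real A := by
    rw [integral_add hI12 (hind1.const_mul _),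
      integral_add (integrable_const _) (hI2.const_mul _), integral_const_mul,
      integral_const_mul, integral_indicator₀ hAm]
    simp
  have hint' : exp (n * y + 1 / 4) ≤ exp (n * y + 1 / 8) + c / 2 * exp (2 * (n * y) + 2)
      + 1 / (2 * c) * μ.real A := by
    have h1 := hlow.trans (hint.trans_eq hrhs)
    have h2 := mul_le_mul_of_nonneg_left hupp (half_pos hc0).le
    linarith
  -- Divide by `exp (n y)`.
  have hE := exp_pos (n * y)
  have hce : c * exp (n * y) = 1 / (8 * exp 2) := by
    rw [hc, exp_neg]; field_simp
  have h3 : exp (1 / 4) ≤ exp (1 / 8) + 1 / 16 + 4 * exp 2 * μ.real A := by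
    have e1 : exp (n * y + 1 / 4) = exp (n * y) * exp (1 / 4) := exp_add _ _
    have e2 : exp (n * y + 1 / 8) = exp (n * y) * exp (1 / 8) := exp_add _ _
    have e3 : c / 2 * exp (2 * (n * y) + 2) = exp (n * y) * (1 / 16) := by
      have : exp (2 * (n * y) + 2) = exp (n * y) * exp (n * y) * exp 2 := by
        rw [← exp_add, ← exp_add]; congr 1; ring
      rw [this]
      calc c / 2 * (exp (n * y) * exp (n * y) * exp 2) =
            (c * exp (n * y)) * (exp (n * y) * exp 2 / 2) := by ring
        _ = _ := by rw [hce]; field_simp; norm_num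
    have e4 : 1 / (2 * c) = exp (n * y) * (4 * exp 2) := by
      rw [hc, exp_neg]; field_simp; norm_num
    rw [e1, e2, e3, e4, mul_assoc, ← mul_add, ← mul_add] at hint'
    exact le_of_mul_le_mul_left hint' hE
  have h4 : exp (1 / 8) * (9 / 8) ≤ exp (1 / 4) := by
    have : exp (1 / 4 : ℝ) = exp (1 / 8) * exp (1 / 8) := by rw [← exp_add]; norm_num
    rw [this]
    have := add_one_le_exp (1 / 8 : ℝ)
    exact mul_le_mul_of_nonneg_left (by linarith) (exp_pos _).le
  have h5 : (1 : ℝ) ≤ exp (1 / 8) := one_le_exp (by norm_num)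
  have h6 : exp 2 ≤ 8 := by
    have : exp (2 : ℝ) = exp 1 * exp 1 := by rw [← exp_add]; norm_num
    rw [this]
    have := exp_one_lt_d9
    nlinarith [exp_pos (1 : ℝ)]
  have h7 : 0 ≤ μ.real A := measureReal_nonneg
  nlinarith

lemma emp_var_lt_one (hn : 4096 ≤ n) :
    μ.real {ω | (∑ i, g i ω ^ 2) / n - ((∑ i, g i ω) / n) ^ 2 < 1} ≤ 1 - 1 / 1024 := by
  have hn0 : (4096 : ℝ) ≤ n := by exact_mod_cast hn
  have hn1 : (0 : ℝ) < n := by linarith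
  have hsq : (64 : ℝ) ≤ √n := by
    rw [show (64 : ℝ) = √4096 by
      rw [show (4096 : ℝ) = 64 ^ 2 by norm_num, sqrt_sq (by norm_num)]]
    exact sqrt_le_sqrt hn0
  have hsubset : {ω | (∑ i, g i ω ^ 2) / n - ((∑ i, g i ω) / n) ^ 2 < 1} ⊆
      {ω | n + √n / 4 < ∑ i, g i ω ^ 2}ᶜ ∪ {ω | n * (√n / 4) ≤ (∑ i, g i ω) ^ 2} := by
    intro ω hω
    by_contra hcon
    simp only [Set.mem_union, Set.mem_compl_iff, Set.mem_ofPred_eq, not_or, not_le,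
      not_not] at hcon
    obtain ⟨h1, h2⟩ := hcon
    refine (not_lt.2 ?_) (show _ < (1 : ℝ) from hω)
    have e : (∑ i, g i ω ^ 2) / n - ((∑ i, g i ω) / n) ^ 2 =
        (n * (∑ i, g i ω ^ 2) - (∑ i, g i ω) ^ 2) / n ^ 2 := by field_simp
    rw [e, le_div_iff₀ (by positivity)]
    nlinarith
  have hm : NullMeasurableSet {ω | n + √n / 4 < ∑ i, g i ω ^ 2} μ :=
    nullMeasurableSet_lt aemeasurable_const
      (Finset.aemeasurable_fun_sum _ fun i _ => (hlaw i).aemeasurable.pow_const 2)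
  have h1 := sum_sq_anticoncentration hind hlaw (by omega)
  have h2 := sq_sum_tail hind hlaw (by omega) (a := √n / 4) (by positivity)
  have h3 : exp (-(√n / 4 / 2)) ≤ 1 / 2048 := by
    have e1 : exp (-(√n / 4 / 2)) ≤ exp (-8) := by rw [exp_le_exp]; linarith
    have e2 : (2048 : ℝ) ≤ exp 8 := by
      have h : exp (8 : ℝ) = exp 1 ^ 8 := by rw [← exp_nat_mul]; norm_num
      rw [h]
      have := exp_one_gt_d9
      calc (2048 : ℝ) ≤ 2.7 ^ 8 := by norm_num
        _ ≤ exp 1 ^ 8 := by gcongr; linarith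
    refine e1.trans ?_
    rw [exp_neg, one_div]
    exact inv_anti₀ (by norm_num) e2
  have h4 : μ.real {ω | n + √n / 4 < ∑ i, g i ω ^ 2}ᶜ =
      1 - μ.real {ω | n + √n / 4 < ∑ i, g i ω ^ 2} := by
    rw [measureReal_compl₀ hm]; simp
  calc _ ≤ _ := measureReal_mono hsubset
    _ ≤ _ := measureReal_union_le _ _
    _ ≤ _ := by rw [h4]; linarith

/-- One-sided lower tail with the exact rate `exp (-t)`, for every `t`. For small `t` the union
bound is useless and anticoncentration of the empirical variance takes its place. -/
lemma emp_var_lower_tail {r t : ℝ} (hr : 1 ≤ r) (hn : 4096 ≤ n)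
    (hnt : 131136 * (r ^ 2 * t) ≤ n) :
    μ.real {ω | (∑ i, g i ω ^ 2) / n - ((∑ i, g i ω) / n) ^ 2 < 1 - 1 / (2 * r)} ≤ exp (-t) := by
  have hn0 : (0 : ℝ) < n := by
    have : (4096 : ℝ) ≤ n := by exact_mod_cast hn
    linarith
  have hr0 : 0 < r := by linarith
  rcases le_total t (1 / 1024) with h | h
  · have h1 := emp_var_lt_one hind hlaw hn
    have h2 : {ω | (∑ i, g i ω ^ 2) / n - ((∑ i, g i ω) / n) ^ 2 < 1 - 1 / (2 * r)} ⊆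
        {ω | (∑ i, g i ω ^ 2) / n - ((∑ i, g i ω) / n) ^ 2 < 1} := by
      intro ω hω
      have h3 : (∑ i, g i ω ^ 2) / n - ((∑ i, g i ω) / n) ^ 2 < 1 - 1 / (2 * r) := hω
      have : 0 < 1 / (2 * r) := by positivity
      exact h3.trans (by linarith)
    have h3 := measureReal_mono (μ := μ) h2
    have h4 := add_one_le_exp (-t)
    linarith
  · have hsubset : {ω | (∑ i, g i ω ^ 2) / n - ((∑ i, g i ω) / n) ^ 2 < 1 - 1 / (2 * r)} ⊆
        {ω | ∑ i, g i ω ^ 2 ≤ n * (1 - 1 / (4 * r))} ∪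
          {ω | n * (n * (1 / (4 * r))) ≤ (∑ i, g i ω) ^ 2} := by
      intro ω hω
      by_contra hcon
      simp only [Set.mem_union, Set.mem_ofPred_eq, not_or, not_le] at hcon
      obtain ⟨h1, h2⟩ := hcon
      refine (not_lt.2 ?_) (show _ < 1 - 1 / (2 * r) from hω)
      have e1 : 1 - 1 / (4 * r) ≤ (∑ i, g i ω ^ 2) / n := (le_div_iff₀' hn0).2 h1.le
      have e3 : ((∑ i, g i ω) / n) ^ 2 ≤ 1 / (4 * r) := by
        rw [div_pow, div_le_iff₀ (by positivity)]
        nlinarith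
      have e4 : 1 / (2 * r) = 1 / (4 * r) + 1 / (4 * r) := by field_simp; norm_num
      rw [e4]
      linarith
    have h1 := sum_sq_lower_tail hind hlaw (ε := 1 / (4 * r)) (by positivity)
    have h2 := sq_sum_tail hind hlaw (by omega) (a := n * (1 / (4 * r))) (by positivity)
    -- The spare `2048 t ≥ 2` in the exponent pays for the factor `3` of the union bound.
    have hkey : 2049 * t ≤ n / (64 * r ^ 2) := by
      rw [le_div_iff₀ (by positivity)]; linarith
    have e1 : exp (-(n * (1 / (4 * r)) ^ 2 / 4)) ≤ exp (-(2049 * t)) := by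
      rw [exp_le_exp, neg_le_neg_iff]
      refine hkey.trans_eq ?_
      field_simp
      norm_num
    have e2 : exp (-(n * (1 / (4 * r)) / 2)) ≤ exp (-(2049 * t)) := by
      rw [exp_le_exp, neg_le_neg_iff]
      refine hkey.trans ?_
      rw [div_le_iff₀ (by positivity)]
      have : n * (1 / (4 * r)) / 2 * (64 * r ^ 2) = n * (8 * r) := by field_simp; norm_num
      rw [this]
      nlinarith
    have e3 : 3 * exp (-(2049 * t)) ≤ exp (-t) := by
      have h5 : (3 : ℝ) ≤ exp 2 := by linarith [add_one_le_exp (2 : ℝ)]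
      have h6 : exp 2 ≤ exp (2048 * t) := by rw [exp_le_exp]; linarith
      have h7 : exp (-t) = exp (2048 * t) * exp (-(2049 * t)) := by
        rw [← exp_add]; congr 1; ring
      rw [h7]
      exact mul_le_mul_of_nonneg_right (h5.trans h6) (exp_pos _).le
    calc _ ≤ _ := measureReal_mono hsubset
      _ ≤ _ := measureReal_union_le _ _
      _ ≤ _ := by linarith

end

end Scalar

/-! ### One-dimensional marginals of the empirical covariance -/

section Marginals

open MeasureTheory ProbabilityTheory

variable {n : ℕ}

lemma bilin_empCov (x : Fin n → EuclideanSpace ℝ (Fin p)) (u u' : EuclideanSpace ℝ (Fin p)) :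
    bilin (empCov x) u u' =
      (1 / (n : ℝ)) * ∑ i, ⟪u, x i - empMean x⟫ * ⟪u', x i - empMean x⟫ := by
  rw [empCov, bilin_smul, ← hsInner_outer, hsInner, Matrix.transpose_sum, Matrix.sum_mul,
    Matrix.trace_sum]
  congr 1
  exact Finset.sum_congr rfl fun i _ => by rw [← hsInner, hsInner_outer, bilin_outer,
    real_inner_comm, real_inner_comm u']

lemma transpose_empCov (x : Fin n → EuclideanSpace ℝ (Fin p)) :
    (empCov x).transpose = empCov x := by
  ext i j
  simp [empCov, Matrix.sum_apply, outer, mul_comm]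

lemma inner_sub_empMean (hn : 1 ≤ n) (x : Fin n → EuclideanSpace ℝ (Fin p))
    (m u : EuclideanSpace ℝ (Fin p)) (i : Fin n) :
    ⟪u, x i - empMean x⟫ = ⟪u, x i - m⟫ - (∑ j, ⟪u, x j - m⟫) / n := by
  have hn0 : (n : ℝ) ≠ 0 := by exact_mod_cast (by omega : n ≠ 0)
  simp only [empMean, inner_sub_right, inner_smul_right, inner_sum, Finset.sum_sub_distrib,
    Finset.sum_const, Finset.card_univ, Fintype.card_fin, nsmul_eq_mul]
  field_simp
  ring

/-- The quadratic form of the empirical covariance is the empirical variance of the projections. -/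
lemma bilin_empCov_self (hn : 1 ≤ n) (x : Fin n → EuclideanSpace ℝ (Fin p))
    (m u : EuclideanSpace ℝ (Fin p)) :
    bilin (empCov x) u u =
      (∑ i, ⟪u, x i - m⟫ ^ 2) / n - ((∑ i, ⟪u, x i - m⟫) / n) ^ 2 := by
  have hn0 : (n : ℝ) ≠ 0 := by exact_mod_cast (by omega : n ≠ 0)
  rw [bilin_empCov]
  simp only [inner_sub_empMean hn x m u]
  generalize ht : (∑ j, ⟪u, x j - m⟫) / n = t
  have ht' : ∑ j, ⟪u, x j - m⟫ = n * t := by rw [← ht]; field_simp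
  have h : ∑ i, (⟪u, x i - m⟫ - t) * (⟪u, x i - m⟫ - t) =
      ∑ i, ⟪u, x i - m⟫ ^ 2 - 2 * t * (n * t) + n * t ^ 2 := by
    have : ∀ i, (⟪u, x i - m⟫ - t) * (⟪u, x i - m⟫ - t) =
        ⟪u, x i - m⟫ ^ 2 - 2 * t * ⟪u, x i - m⟫ + t ^ 2 := fun i => by ring
    simp only [this, Finset.sum_add_distrib, Finset.sum_sub_distrib, ← Finset.mul_sum, ht',
      Finset.sum_const, Finset.card_univ, Fintype.card_fin, nsmul_eq_mul]
  rw [h]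
  field_simp
  ring

variable {Ω : Type*} [MeasurableSpace Ω] {μ : Measure Ω}

lemma hasLaw_inner {Sig : Matrix (Fin p) (Fin p) ℝ} (hSig : Sig.PosSemidef)
    {m : EuclideanSpace ℝ (Fin p)} {X : Ω → EuclideanSpace ℝ (Fin p)}
    (hX : HasLaw X (multivariateGaussian m Sig) μ) (d : EuclideanSpace ℝ (Fin p)) :
    HasLaw (fun ω => ⟪d, X ω - m⟫) (gaussianReal 0 (bilin Sig d d).toNNReal) μ := by
  have h1 : HasLaw (fun z => ⟪d, z⟫) (gaussianReal ⟪d, m⟫ (bilin Sig d d).toNNReal)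
      (multivariateGaussian m Sig) := by
    refine ⟨by fun_prop, ?_⟩
    have h := IsGaussian.map_eq_gaussianReal (μ := multivariateGaussian m Sig) (innerSL ℝ d)
    have hmean : ∫ z, innerSL ℝ d z ∂(multivariateGaussian m Sig) = ⟪d, m⟫ := by
      rw [ContinuousLinearMap.integral_comp_id_comm IsGaussian.integrable_id]
      simp
    have hvar : Var[innerSL ℝ d; multivariateGaussian m Sig] = bilin Sig d d := by
      have h2 := covarianceBilin_self (μ := multivariateGaussian m Sig)
        IsGaussian.memLp_two_id d
      rw [covarianceBilin_multivariateGaussian hSig] at h2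
      refine (Eq.trans h2 rfl).symm.trans ?_
      rw [bilin_eq_inner, Matrix.inner_toEuclideanCLM]
    rw [hmean, hvar] at h
    exact h
  have h2 := h1.comp hX
  have h3 := gaussianReal_sub_const h2 ⟪d, m⟫
  rw [sub_self] at h3
  refine h3.congr (Filter.Eventually.of_forall fun ω => ?_)
  simp [inner_sub_right]

variable [IsProbabilityMeasure μ] {Sig : Matrix (Fin p) (Fin p) ℝ} (hSig : Sig.PosSemidef)
  {m : EuclideanSpace ℝ (Fin p)} {x : Fin n → Ω → EuclideanSpace ℝ (Fin p)}
  (hind : iIndepFun x μ) (hlaw : ∀ i, HasLaw (x i) (multivariateGaussian m Sig) μ)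

include hSig hlaw

omit [IsProbabilityMeasure μ] in
lemma ae_inner_eq_zero {d : EuclideanSpace ℝ (Fin p)} (hd : bilin Sig d d = 0) :
    ∀ᵐ ω ∂μ, ∀ i, ⟪d, x i ω - m⟫ = 0 := by
  rw [ae_all_iff]
  intro i
  have h := hasLaw_inner hSig (hlaw i) d
  rw [hd, Real.toNNReal_zero, gaussianReal_zero_var] at h
  exact h.ae_eq_of_dirac

include hind

omit [IsProbabilityMeasure μ] in
/-- In a nondegenerate direction the empirical covariance is a multiple of the empirical variance
of standard Gaussian variables. -/
lemma exists_standardization (hn : 1 ≤ n) {d : EuclideanSpace ℝ (Fin p)}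
    (hd : 0 < bilin Sig d d) :
    ∃ g : Fin n → Ω → ℝ, iIndepFun g μ ∧ (∀ i, HasLaw (g i) (gaussianReal 0 1) μ) ∧
      ∀ ω, bilin (empCov fun i => x i ω) d d =
        bilin Sig d d * ((∑ i, g i ω ^ 2) / n - ((∑ i, g i ω) / n) ^ 2) := by
  have hτ : 0 < √(bilin Sig d d) := Real.sqrt_pos.2 hd
  refine ⟨fun i ω => ⟪d, x i ω - m⟫ / √(bilin Sig d d), ?_, fun i => ?_, fun ω => ?_⟩
  · exact hind.comp (fun _ z => ⟪d, z - m⟫ / √(bilin Sig d d)) fun _ => by fun_prop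
  · have h := gaussianReal_div_const (hasLaw_inner hSig (hlaw i) d) √(bilin Sig d d)
    have e : (bilin Sig d d).toNNReal / (NNReal.mk (√(bilin Sig d d) ^ 2) (sq_nonneg _)) = 1 := by
      have e2 : NNReal.mk (√(bilin Sig d d) ^ 2) (sq_nonneg _) = (bilin Sig d d).toNNReal := by
        ext
        rw [Real.coe_toNNReal _ hd.le]
        exact Real.sq_sqrt hd.le
      rw [e2, div_self]
      exact (Real.toNNReal_pos.2 hd).ne'
    rw [zero_div] at h
    convert h using 2
    exact e.symm
  · rw [bilin_empCov_self hn _ m]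
    have e1 : ∑ i, (⟪d, x i ω - m⟫ / √(bilin Sig d d)) ^ 2 =
        (∑ i, ⟪d, x i ω - m⟫ ^ 2) / bilin Sig d d := by
      simp only [div_pow, Real.sq_sqrt hd.le, Finset.sum_div]
    have e2 : (∑ i, ⟪d, x i ω - m⟫ / √(bilin Sig d d)) / (n : ℝ) =
        (∑ i, ⟪d, x i ω - m⟫) / n / √(bilin Sig d d) := by
      rw [← Finset.sum_div, div_right_comm]
    rw [e1, e2, div_pow _ √(bilin Sig d d), Real.sq_sqrt hd.le]
    field_simp

lemma direction_two_sided (hn : 1 ≤ n) (d : EuclideanSpace ℝ (Fin p)) {ε : ℝ} (hε : 0 ≤ ε)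
    (hε' : ε ≤ 1) :
    μ.real {ω | ε * bilin Sig d d <
      |bilin (empCov fun i => x i ω) d d - bilin Sig d d|} ≤
      4 * Real.exp (-(n * ε ^ 2 / 16)) := by
  have h0 : 0 ≤ bilin Sig d d := by
    rw [bilin_eq_inner, Matrix.inner_toEuclideanCLM]
    simpa using hSig.dotProduct_mulVec_nonneg d
  rcases h0.eq_or_lt with hd | hd
  · have hnull : μ {ω | ε * bilin Sig d d <
        |bilin (empCov fun i => x i ω) d d - bilin Sig d d|} = 0 := by
      rw [measure_eq_zero_iff_ae_notMem]
      filter_upwards [ae_inner_eq_zero hSig hlaw hd.symm] with ω hω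
      simp [← hd, bilin_empCov_self hn _ m, hω]
    rw [measureReal_def, hnull]
    simp only [ENNReal.toReal_zero]
    positivity
  · obtain ⟨g, hg, hgl, hV⟩ := exists_standardization hSig hind hlaw hn hd
    refine le_trans (le_of_eq ?_) (emp_var_two_sided hg hgl hn hε hε')
    congr 1
    ext ω
    have e : bilin (empCov fun i => x i ω) d d - bilin Sig d d =
        bilin Sig d d * ((∑ i, g i ω ^ 2) / n - ((∑ i, g i ω) / n) ^ 2 - 1) := by
      rw [hV]; ring
    simp only [Set.mem_ofPred_eq]
    rw [e, abs_mul, abs_of_pos hd, mul_comm ε]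
    exact mul_lt_mul_iff_right₀ hd

lemma direction_lower_tail (hn : 4096 ≤ n) {d : EuclideanSpace ℝ (Fin p)}
    (hd : 0 < bilin Sig d d) {r t : ℝ} (hr : 1 ≤ r) (hnt : 131136 * (r ^ 2 * t) ≤ n) :
    μ.real {ω | bilin (empCov fun i => x i ω) d d < bilin Sig d d * (1 - 1 / (2 * r))} ≤
      Real.exp (-t) := by
  obtain ⟨g, hg, hgl, hV⟩ := exists_standardization hSig hind hlaw (by omega) hd
  refine le_trans (le_of_eq ?_) (emp_var_lower_tail hg hgl hr hn hnt)
  congr 1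
  ext ω
  simp only [Set.mem_ofPred_eq]
  rw [hV]
  exact mul_lt_mul_iff_right₀ hd

end Marginals

/-! ### Uniform bounds in the spiked model -/

section Spiked

open MeasureTheory ProbabilityTheory

variable {n s : ℕ} {v : EuclideanSpace ℝ (Fin p)} {σ₁ : ℝ} {Sig Sig₂ : Matrix (Fin p) (Fin p) ℝ}

/-- Rescaling by `σ₁^{-1/2}` along `v` and by `σ₂^{-1/2}` on its complement. The spiked covariance
becomes at most the identity after this change of variables. -/
noncomputable def whiten (v : EuclideanSpace ℝ (Fin p)) (σ₁ σ₂ : ℝ) :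
    EuclideanSpace ℝ (Fin p) →ₗ[ℝ] EuclideanSpace ℝ (Fin p) :=
  (√σ₂)⁻¹ • LinearMap.id + ((√σ₁)⁻¹ - (√σ₂)⁻¹) • (innerₛₗ ℝ v).smulRight v

lemma whiten_apply (σ₁ σ₂ : ℝ) (z : EuclideanSpace ℝ (Fin p)) :
    whiten v σ₁ σ₂ z = (√σ₁)⁻¹ • ⟪v, z⟫ • v + (√σ₂)⁻¹ • perp v z := by
  have h : whiten v σ₁ σ₂ z = (√σ₂)⁻¹ • z + ((√σ₁)⁻¹ - (√σ₂)⁻¹) • ⟪v, z⟫ • v := rfl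
  rw [h, perp, smul_sub, sub_smul]
  abel

lemma whiten_orth {σ₂ : ℝ} {z : EuclideanSpace ℝ (Fin p)} (hz : ⟪v, z⟫ = 0) :
    whiten v σ₁ σ₂ z = (√σ₂)⁻¹ • z := by
  simp [whiten_apply, perp, hz]

lemma whiten_self {σ₂ : ℝ} (hv : ‖v‖ = 1) : whiten v σ₁ σ₂ v = (√σ₁)⁻¹ • v := by
  simp [whiten_apply, perp, hv]

lemma transpose_eq_of_posSemidef (hSig : Sig.PosSemidef) : Sig.transpose = Sig := by
  have := hSig.isHermitian
  rwa [Matrix.IsHermitian, Matrix.conjTranspose_eq_transpose_of_trivial] at this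

lemma bilin_spiked (hS : Sig = σ₁ • outer v v + Sig₂) (u u' : EuclideanSpace ℝ (Fin p)) :
    bilin Sig u u' = σ₁ * (⟪v, u⟫ * ⟪v, u'⟫) + bilin Sig₂ u u' := by
  rw [hS, bilin_add, bilin_smul, bilin_outer]

/-- The covariance is dominated by the identity in the rescaled variables. -/
lemma bilin_whiten_le (hv : ‖v‖ = 1) (hS : Sig = σ₁ • outer v v + Sig₂)
    (hsymm : Sig₂.transpose = Sig₂) (hSv : Sig₂.mulVec v = 0) (hσ₁ : 0 < σ₁)
    (hσ₂ : 0 < opNorm Sig₂) (z : EuclideanSpace ℝ (Fin p)) :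
    bilin Sig (whiten v σ₁ (opNorm Sig₂) z) (whiten v σ₁ (opNorm Sig₂) z) ≤ ‖z‖ ^ 2 := by
  have h1 : ⟪v, whiten v σ₁ (opNorm Sig₂) z⟫ = (√σ₁)⁻¹ * ⟪v, z⟫ := by
    rw [whiten_apply, inner_add_right, inner_smul_right, inner_smul_right, inner_smul_right,
      inner_perp hv, real_inner_self_eq_norm_sq, hv]
    ring
  have h2 : perp v (whiten v σ₁ (opNorm Sig₂) z) = (√(opNorm Sig₂))⁻¹ • perp v z := by
    rw [perp, h1, whiten_apply, smul_smul, add_sub_cancel_left]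
  rw [bilin_spiked hS, bilin_perp_perp hsymm hSv, h1, h2, map_smul, map_smul,
    LinearMap.smul_apply, smul_eq_mul, smul_eq_mul]
  have h3 := (le_abs_self _).trans (abs_bilin_le_opNorm Sig₂ (perp v z) (perp v z))
  have e1 : σ₁ * ((√σ₁)⁻¹ * ⟪v, z⟫ * ((√σ₁)⁻¹ * ⟪v, z⟫)) = ⟪v, z⟫ ^ 2 := by
    calc _ = σ₁ / (√σ₁ * √σ₁) * ⟪v, z⟫ ^ 2 := by field_simp
      _ = _ := by rw [Real.mul_self_sqrt hσ₁.le, div_self hσ₁.ne', one_mul]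
  have e2 : (√(opNorm Sig₂))⁻¹ * ((√(opNorm Sig₂))⁻¹ * bilin Sig₂ (perp v z) (perp v z)) ≤
      ‖perp v z‖ ^ 2 := by
    rw [← mul_assoc, ← mul_inv, Real.mul_self_sqrt hσ₂.le, inv_mul_le_iff₀ hσ₂]
    exact h3.trans_eq (by ring)
  rw [e1]
  have := norm_perp_sq hv z
  linarith

variable {Ω : Type*} [MeasurableSpace Ω] {μ : Measure Ω} [IsProbabilityMeasure μ]
  {m : EuclideanSpace ℝ (Fin p)} {x : Fin n → Ω → EuclideanSpace ℝ (Fin p)}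

omit [IsProbabilityMeasure μ] in
/-- Without noise (`Σ₂ = 0`) the data lie on a line parallel to `v` almost surely. -/
lemma ae_noise_eq_zero (hv : ‖v‖ = 1) (hSig : Sig.PosSemidef)
    (hS : Sig = σ₁ • outer v v + Sig₂) (hσ₂ : opNorm Sig₂ = 0)
    (hlaw : ∀ i, HasLaw (x i) (multivariateGaussian m Sig) μ) (hn : 1 ≤ n) :
    ∀ᵐ ω ∂μ, ∀ u w, ⟪v, w⟫ = 0 → bilin (empCov fun i => x i ω) u w = 0 := by
  have h0 : ∀ u w, bilin Sig₂ u w = 0 := fun u w => by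
    have := abs_bilin_le_opNorm Sig₂ u w
    rw [hσ₂, zero_mul] at this
    exact abs_nonpos_iff.1 this
  have hae : ∀ᵐ ω ∂μ, ∀ j : Fin p, ∀ i,
      ⟪perp v (EuclideanSpace.single j (1 : ℝ)), x i ω - m⟫ = 0 := by
    rw [ae_all_iff]
    intro j
    refine ae_inner_eq_zero hSig hlaw ?_
    rw [bilin_spiked hS, h0, inner_perp hv]
    ring
  filter_upwards [hae] with ω hω u w hw
  have hzero : ∀ i, ⟪w, x i ω - m⟫ = 0 := by
    intro i
    have hy : x i ω - m = ⟪v, x i ω - m⟫ • v := by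
      ext j
      have h := hω j i
      rw [perp, inner_sub_left, real_inner_smul_left, EuclideanSpace.inner_single_left,
        EuclideanSpace.inner_single_right] at h
      simp only [map_one, one_mul, conj_trivial] at h
      rw [PiLp.smul_apply, smul_eq_mul]
      linarith
    rw [hy, inner_smul_right, real_inner_comm v w, hw, mul_zero]
  rw [bilin_empCov]
  simp only [inner_sub_empMean hn (fun i => x i ω) m w, hzero]
  simp

lemma exp_complexity (hs : 1 ≤ s) (hsp : s ≤ p) :
    Real.exp (-(s * Real.log (Real.exp 1 * p / s))) =
      Real.exp (-(s : ℝ)) * ((s : ℝ) / p) ^ s := by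
  have hs0 : (0 : ℝ) < s := by exact_mod_cast hs
  have hp0 : (0 : ℝ) < p := hs0.trans_le (by exact_mod_cast hsp)
  have h1 : ((s : ℝ) / p) = Real.exp (-Real.log (p / s)) := by
    rw [← Real.log_inv, Real.exp_log (by positivity), inv_div]
  rw [h1, ← Real.exp_nat_mul, ← Real.exp_add, mul_div_assoc,
    Real.log_mul (Real.exp_pos 1).ne' (by positivity), Real.log_exp]
  congr 1
  ring

lemma one_le_complexity (hs : 1 ≤ s) (hsp : s ≤ p) :
    1 ≤ (s : ℝ) * Real.log (Real.exp 1 * p / s) := by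
  have hs0 : (1 : ℝ) ≤ s := by exact_mod_cast hs
  have hp0 : (s : ℝ) ≤ p := by exact_mod_cast hsp
  have h1 : 0 ≤ Real.log ((p : ℝ) / s) := Real.log_nonneg ((one_le_div (by linarith)).2 hp0)
  rw [mul_div_assoc, Real.log_mul (Real.exp_pos 1).ne' (by
    have : 0 < (p : ℝ) := by linarith
    positivity), Real.log_exp]
  nlinarith

/-- Outside an event of probability `3 e^{-s} (s/p)^s` the noise part of the empirical covariance is
uniformly small, measured by the mixed norm. -/
theorem exists_uniform_event (hs : 1 ≤ s) (hsp : s ≤ p) (hv : ‖v‖ = 1) (hsparse : IsSparse s v)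
    (hSig : Sig.PosSemidef) (hS : Sig = σ₁ • outer v v + Sig₂) (hsymm : Sig₂.transpose = Sig₂)
    (hSv : Sig₂.mulVec v = 0) (hσ : opNorm Sig₂ < σ₁) (hind : iIndepFun x μ)
    (hlaw : ∀ i, HasLaw (x i) (multivariateGaussian m Sig) μ)
    (hn : 256 * ((s : ℝ) * Real.log (Real.exp 1 * p / s)) ≤ n) :
    ∃ F : Set Ω, μ.real F ≤ 3 * (Real.exp (-(s : ℝ)) * ((s : ℝ) / p) ^ s) ∧ ∀ ω ∉ F,
      (∀ u, ⟪v, u⟫ = 0 → |bilin (empCov fun i => x i ω) v u| ≤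
        64 * (√(σ₁ * opNorm Sig₂) * √((s : ℝ) * Real.log (Real.exp 1 * p / s) / n))
          * mixN s u) ∧
      ∀ u u', ⟪v, u⟫ = 0 → ⟪v, u'⟫ = 0 →
        |bilin (empCov fun i => x i ω) u u' - bilin Sig₂ u u'| ≤
          64 * (√(σ₁ * opNorm Sig₂) * √((s : ℝ) * Real.log (Real.exp 1 * p / s) / n))
            * (mixN s u * mixN s u') := by
  set L : ℝ := (s : ℝ) * Real.log (Real.exp 1 * p / s) with hL
  have hL1 : 1 ≤ L := one_le_complexity hs hsp
  have hn0 : (0 : ℝ) < n := by linarith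
  have hn1 : 1 ≤ n := by
    have : 0 < n := by exact_mod_cast hn0
    omega
  have hσ₂0 : 0 ≤ opNorm Sig₂ := norm_nonneg _
  have hσ₁ : 0 < σ₁ := hσ₂0.trans_lt hσ
  rcases hσ₂0.eq_or_lt with hz | hσ₂
  · refine ⟨{ω | ¬ ∀ u w, ⟪v, w⟫ = 0 → bilin (empCov fun i => x i ω) u w = 0}, ?_, ?_⟩
    · have h := ae_noise_eq_zero hv hSig hS hz.symm hlaw hn1
      rw [measureReal_def, ae_iff.1 h]
      simp only [ENNReal.toReal_zero]
      positivity
    · intro ω hω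
      have h := not_not.1 hω
      have h0 : ∀ u w, bilin Sig₂ u w = 0 := fun u w => by
        have := abs_bilin_le_opNorm Sig₂ u w
        rw [← hz, zero_mul] at this
        exact abs_nonpos_iff.1 this
      have hη : 0 ≤ 64 * (√(σ₁ * opNorm Sig₂) * √(L / n)) := by positivity
      refine ⟨fun u hu => ?_, fun u u' _ hu' => ?_⟩
      · rw [h _ _ hu, abs_zero]
        exact mul_nonneg hη (mixN_nonneg s u)
      · rw [h _ _ hu', h0, sub_zero, abs_zero]
        exact mul_nonneg hη (mul_nonneg (mixN_nonneg s u) (mixN_nonneg s u'))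
  · set σ₂ := opNorm Sig₂ with hσ₂def
    set D := whiten v σ₁ σ₂ with hD
    -- With this `ε` each direction fails with probability `4 e^{-16 L}`, which beats the `e^{10 L}`
    -- integer vectors of the union bound.
    set ε : ℝ := 16 * √(L / n) with hε
    have hε0 : 0 ≤ ε := by positivity
    have hε2 : n * ε ^ 2 = 256 * L := by
      rw [hε, mul_pow, Real.sq_sqrt (by positivity)]
      field_simp
      norm_num
    have hε1 : ε ≤ 1 := by
      refine (sq_le_one_iff₀ hε0).1 ?_
      have h1 : n * ε ^ 2 ≤ n * 1 := by rw [hε2, mul_one]; exact hn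
      exact le_of_mul_le_mul_left h1 hn0
    refine ⟨⋃ k ∈ intBall p s, {ω | ε * bilin Sig (D (intVec k)) (D (intVec k)) <
        |bilin (empCov fun i => x i ω) (D (intVec k)) (D (intVec k))
          - bilin Sig (D (intVec k)) (D (intVec k))|}, ?_, ?_⟩
    · refine (measureReal_biUnion_finset_le _ _).trans ?_
      refine (Finset.sum_le_sum fun k _ =>
        direction_two_sided hSig hind hlaw hn1 (D (intVec k)) hε0 hε1).trans ?_
      rw [Finset.sum_const, nsmul_eq_mul, hε2, ← exp_complexity hs hsp, ← hL]
      have hcard := card_intBall_le hs hsp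
      rw [← hL] at hcard
      calc ((intBall p s).card : ℝ) * (4 * Real.exp (-(256 * L / 16))) ≤
            Real.exp (10 * L) * (4 * Real.exp (-(256 * L / 16))) := by gcongr
        _ = 4 * Real.exp (-(5 * L)) * Real.exp (-L) := by
            rw [mul_left_comm, mul_assoc, ← Real.exp_add, ← Real.exp_add]
            congr 2; ring
        _ ≤ 3 * Real.exp (-L) := by
            refine mul_le_mul_of_nonneg_right ?_ (Real.exp_pos _).le
            have h1 : Real.exp (-(5 * L)) ≤ 1 / 2 := by
              rw [Real.exp_neg, one_div]
              refine inv_anti₀ (by norm_num) ?_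
              linarith [Real.add_one_le_exp (5 * L)]
            linarith
    · intro ω hω
      simp only [Set.mem_iUnion, Set.mem_ofPred_eq, not_exists, not_lt] at hω
      set A := empCov fun i => x i ω with hA
      have hAsymm : (A - Sig).transpose = A - Sig := by
        rw [Matrix.transpose_sub, transpose_eq_of_posSemidef hSig, hA, transpose_empCov]
      have hB := abs_le_mixN_of_intVec (B := (bilin (A - Sig)).compl₁₂ D D) hs hsp hε0
        (fun u w => by
          simp only [LinearMap.compl₁₂_apply]
          exact bilin_symm hAsymm _ _)
        (fun k hk => by
          simp only [LinearMap.compl₁₂_apply]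
          rw [bilin_sub]
          refine (hω k (mem_intBall hk)).trans (mul_le_mul_of_nonneg_left ?_ hε0)
          exact bilin_whiten_le hv hS hsymm hSv hσ₁ hσ₂ (intVec k))
      simp only [LinearMap.compl₁₂_apply] at hB
      have hs1 : 0 < √σ₁ := Real.sqrt_pos.2 hσ₁
      have hs2 : 0 < √σ₂ := Real.sqrt_pos.2 hσ₂
      have hprod : √(σ₁ * σ₂) = √σ₁ * √σ₂ := Real.sqrt_mul hσ₁.le _
      refine ⟨fun u hu => ?_, fun u u' hu hu' => ?_⟩
      · have h := hB v u
        rw [hD, whiten_self hv, whiten_orth hu, map_smul, map_smul, LinearMap.smul_apply,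
          smul_eq_mul, smul_eq_mul, bilin_sub, bilin_spiked hS, hu, bilin_symm hsymm,
          bilin_right_eq_zero hSv, mul_zero, mul_zero, add_zero, sub_zero, abs_mul, abs_mul,
          abs_of_pos (inv_pos.2 hs1), abs_of_pos (inv_pos.2 hs2), inv_mul_le_iff₀ hs2,
          inv_mul_le_iff₀ hs1] at h
        have hm := mul_le_mul_of_nonneg_right (mixN_le_two hv hsparse hs) (mixN_nonneg s u)
        calc |bilin A v u| ≤ √σ₁ * (√σ₂ * (2 * ε * (mixN s v * mixN s u))) := h
          _ ≤ √σ₁ * (√σ₂ * (2 * ε * (2 * mixN s u))) := by gcongr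
          _ = _ := by rw [hprod, hε]; ring
      · have h := hB u u'
        rw [hD, whiten_orth hu, whiten_orth hu', map_smul, map_smul, LinearMap.smul_apply,
          smul_eq_mul, smul_eq_mul, bilin_sub, bilin_spiked hS, hu, zero_mul, mul_zero, zero_add,
          abs_mul, abs_mul, abs_of_pos (inv_pos.2 hs2), inv_mul_le_iff₀ hs2,
          inv_mul_le_iff₀ hs2] at h
        have hle : √σ₂ ≤ √σ₁ := Real.sqrt_le_sqrt hσ.le
        have hmm := mul_nonneg (mixN_nonneg s u) (mixN_nonneg s u')
        calc |bilin A u u' - bilin Sig₂ u u'| ≤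
              √σ₂ * (√σ₂ * (2 * ε * (mixN s u * mixN s u'))) := h
          _ ≤ √σ₁ * (√σ₂ * (4 * ε * (mixN s u * mixN s u'))) := by
              gcongr
              norm_num
          _ = _ := by rw [hprod, hε]; ring

end Spiked

end SparsePCA

theorem theorem2 :
    ∃ C₁ C₂ C₃ : ℝ, 0 < C₁ ∧ 0 < C₂ ∧ 0 < C₃ ∧
      ∀ (n p s : ℕ), 1 ≤ s → s ≤ p →
      ∀ (m v₁ : EuclideanSpace ℝ (Fin p)) (σ₁ σ₂ : ℝ) (Sig Sig₂ : Matrix (Fin p) (Fin p) ℝ),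
        Sig.PosSemidef → Sig = σ₁ • SparsePCA.outer v₁ v₁ + Sig₂ →
        SparsePCA.IsSparse s v₁ → ‖v₁‖ = 1 →
        σ₂ = SparsePCA.opNorm Sig₂ → σ₂ < σ₁ → Sig₂.mulVec v₁ = 0 →
      ∀ (Ω : Type*) [MeasurableSpace Ω] (ℙ : MeasureTheory.Measure Ω)
        [MeasureTheory.IsProbabilityMeasure ℙ] (x : Fin n → Ω → EuclideanSpace ℝ (Fin p)),
        ProbabilityTheory.iIndepFun x ℙ →
        (∀ i, ProbabilityTheory.HasLaw (x i)
          (ProbabilityTheory.multivariateGaussian m Sig) ℙ) →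
      ∀ lam : ℝ,
        C₁ * (√(σ₁ * σ₂) * √((s : ℝ) * Real.log (Real.exp 1 * p / s) / n)) ≤ lam →
      ∀ t : ℝ, 0 < t →
        C₂ * max ((s : ℝ) * Real.log (Real.exp 1 * p / s)) ((σ₁ / (σ₁ - σ₂)) ^ 2 * t) ≤ n →
        ∃ E : Set Ω, MeasurableSet E ∧
          1 - Real.exp (-t) - 3 * Real.exp (-(s : ℝ)) * ((s : ℝ) / p) ^ s ≤ ℙ.real E ∧
          ∀ ω ∈ E,
            (∃ P, SparsePCA.IsPCASolution s lam (SparsePCA.empCov fun i => x i ω) P) ∧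
            ∀ P, SparsePCA.IsPCASolution s lam (SparsePCA.empCov fun i => x i ω) P →
              SparsePCA.frobNorm (P - SparsePCA.outer v₁ v₁) ≤ C₃ * (lam / (σ₁ - σ₂)) := by
  -- `2880 = 45 * 64`: the noise level is `64 √(σ₁ σ₂ L / n)`, and absorbing it takes the factor `45`.
  refine ⟨2880, 131136, 20, by norm_num, by norm_num, by norm_num, ?_⟩
  intro n p s hs hsp m v σ₁ σ₂ Sig Sig₂ hSig hS hsparse hv hσ₂ hσ hSv Ω _ μ _ x hind hlaw lam hlam
    t _ hn
  subst hσ₂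
  have hsymm : Sig₂.transpose = Sig₂ := by
    have h1 := SparsePCA.transpose_eq_of_posSemidef hSig
    have h2 : (SparsePCA.outer v v).transpose = SparsePCA.outer v v := by
      ext i j; simp [SparsePCA.outer, mul_comm]
    have h3 : Sig₂ = Sig - σ₁ • SparsePCA.outer v v := by rw [hS]; abel
    rw [h3, Matrix.transpose_sub, Matrix.transpose_smul, h1, h2]
  have hL1 := SparsePCA.one_le_complexity hs hsp
  have hσ₂0 : 0 ≤ SparsePCA.opNorm Sig₂ := norm_nonneg _
  have hσ₁ : 0 < σ₁ := hσ₂0.trans_lt hσ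
  have hgap : 0 < σ₁ - SparsePCA.opNorm Sig₂ := sub_pos.2 hσ
  have hnL : 131136 * ((s : ℝ) * Real.log (Real.exp 1 * p / s)) ≤ n :=
    (mul_le_mul_of_nonneg_left (le_max_left _ _) (by norm_num)).trans hn
  have hnt : 131136 * ((σ₁ / (σ₁ - SparsePCA.opNorm Sig₂)) ^ 2 * t) ≤ n :=
    (mul_le_mul_of_nonneg_left (le_max_right _ _) (by norm_num)).trans hn
  have hn4096 : 4096 ≤ n := by
    have : (4096 : ℝ) ≤ n := by linarith
    exact_mod_cast this
  obtain ⟨F, hF, hgood⟩ := SparsePCA.exists_uniform_event hs hsp hv hsparse hSig hS hsymm hSv hσ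
    hind hlaw (by linarith)
  have hvv : SparsePCA.bilin Sig v v = σ₁ := by
    rw [SparsePCA.bilin_spiked hS, SparsePCA.bilin_right_eq_zero hSv, real_inner_self_eq_norm_sq,
      hv]
    ring
  have hspike := SparsePCA.direction_lower_tail hSig hind hlaw hn4096 (d := v)
    (by rw [hvv]; exact hσ₁) (r := σ₁ / (σ₁ - SparsePCA.opNorm Sig₂))
    ((one_le_div hgap).2 (by linarith)) hnt
  set G : Set Ω := {ω | SparsePCA.bilin (SparsePCA.empCov fun i => x i ω) v v <
    SparsePCA.bilin Sig v v * (1 - 1 / (2 * (σ₁ / (σ₁ - SparsePCA.opNorm Sig₂))))} with hG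
  -- The data are only almost everywhere measurable, so the bad event is enlarged to a measurable set.
  refine ⟨(MeasureTheory.toMeasurable μ (G ∪ F))ᶜ,
    (MeasureTheory.measurableSet_toMeasurable _ _).compl, ?_, fun ω hω => ?_⟩
  · rw [MeasureTheory.probReal_compl_eq_one_sub (MeasureTheory.measurableSet_toMeasurable _ _),
      MeasureTheory.measureReal_def, MeasureTheory.measure_toMeasurable,
      ← MeasureTheory.measureReal_def]
    have := MeasureTheory.measureReal_union_le (μ := μ) G F
    linarith
  · have hnot : ω ∉ G ∪ F := fun h => hω (MeasureTheory.subset_toMeasurable _ _ h)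
    obtain ⟨hωG, hωF⟩ := not_or.1 hnot
    obtain ⟨hcross, hperp⟩ := hgood ω hωF
    refine ⟨SparsePCA.exists_isPCASolution _ _ _, fun P hP => ?_⟩
    refine SparsePCA.frobNorm_sub_le hs hv hsparse (by positivity) (by linarith)
      (SparsePCA.transpose_empCov _) hsymm hSv hcross hperp hgap ?_ hP
    simp only [hG, Set.mem_ofPred_eq, not_lt] at hωG
    rw [hvv] at hωG
    refine le_trans (le_of_eq ?_) hωG
    field_simp
    ring
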